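/- Let $K\ge 1$, and for each $k=1,\dots,K$ let $(X^k_t)_{t\ge1}$ be i.i.d. real random variables with mean $\mu>0$ (the same for all $k$) and standard deviation $\sigma_k\in(0,\infty)$, the $K$ sequences being independent of each other. Put $S^k_t=X^k_1+\dots+X^k_t$. For thresholds $\Delta^k>0$ define $\tau^k_0=0$, $\tau^k_n=\inf\{t\ge\tau^k_{n-1}: S^k_t-S^k_{\tau^k_{n-1}}\ge\Delta^k\}$ for $n\ge 1$, $N^k_t=\max\{n:\tau^k_n<t\}$, $\tau^k(t)=\tau^k_{N^k_t}$, and $$\hat\mu^k_t=\frac{\Delta^kN^k_t}{\tau^k(t)},\qquad \check\mu^k_t=\frac{\Delta^kN^k_t}{t}$$ (with $\hat\mu_t^k=0$ if $N^k_t=0$). Let $w_k=\sigma_k^{-2}/\sum_j\sigma_j^{-2}$ and let $$s^2=\sum_{k=1}^Kw_k^2\sigma_k^2=\Big(\sum_{k=1}^K\sigma_k^{-2}\Big)^{-1},$$ so that $s^2/t$ is the variance of the optimal linear estimator $\sum_kw_kS^k_t/t$ that uses all observations. Put $\underline\Delta=\min_k\Delta^k$ and $\overline\Delta=\max_k\Delta^k$.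 All limits are taken along an arbitrary sequence of times $t\in\mathbb N$, $t\to\infty$, and thresholds $(\Delta^1,\dots,\Delta^K)$ satisfying the stated growth conditions; $a\ll b$ means $a=o(b)$. (i) If $\sqrt t\ll\underline\Delta$ and $\overline\Delta\ll t$, then $$\frac{\sum_kw_k\hat\mu^k_t-\mu}{s/\sqrt t}\to\mathcal N(0,1)\quad\text{in distribution.}$$ (ii) Suppose in addition that for each $k$ the law of $X^k_1$ is the member $P^k_\mu$ of a family $(P^k_\theta)_{\theta>0}$ of probability laws on $\mathbb R$, where $P^k_\theta$ has mean $\theta$ and finite variance and is non-lattice (not carried by $d\mathbb Z$ for any $d>0$). Let $m_k(\theta,\Delta)$ be the expected overshoot $\mathsf E[S_{\tau}-\Delta]$, $\tau=\inf\{t: S_t\ge\Delta\}$, of a random walk $S$ with i.i.d. increments of law $P^k_\theta$, let $\rho_k(\theta)=\lim_{\Delta\to\infty}m_k(\theta,\Delta)$, and let $g_k(x)=x\,(1+\rho_k(x)/\Delta^k)$. Suppose that for each $k$: - (A1) $\mathsf E[|X^k_1|^{r+1}]<\infty$ for some real $r\ge2$; - (A2) $|m_k(\mu,\Delta)-\rho_k(\mu)|=O(\Delta^{-(r-1)})$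 as $\Delta\to\infty$ for some real $r\ge2$; - (A3) $\theta\mapsto\rho_k(\theta)$ is Lipschitz on $(0,\infty)$. If $t^{1/4}\ll\underline\Delta$ and $\overline\Delta\ll t$, then $$\frac{\sum_kw_kg_k(\hat\mu^k_t)-\mu}{s/\sqrt t}\to\mathcal N(0,1)\quad\text{in distribution.}$$ If, additionally, $\overline\Delta\ll\sqrt t$, then $$\frac{\sum_kw_kg_k(\check\mu^k_t)-\mu}{s/\sqrt t}\to\mathcal N(0,1)\quad\text{in distribution.}$$ -/

import Mathlib

open MeasureTheory ProbabilityTheory Filter Topology Asymptotics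
open scoped NNReal ENNReal

noncomputable section

namespace SensorFusion

/-! Quantities attached to one path `x 0, x 1, …` of observations of a single sensor
(`x i` is the observation made at time `i + 1`) and a threshold `Δ`. -/

/-- The random walk `S_t`, the sum of the first `t` observations. -/
def walk (x : ℕ → ℝ) (t : ℕ) : ℝ := ∑ i ∈ Finset.range t, x i

/-- The communication times: `τ_0 = 0` and
`τ_{n+1} = inf {m ≥ τ_n : S_m - S_{τ_n} ≥ Δ}`, with `inf ∅ = ∞`. -/
def commTime (Δ : ℝ) (x : ℕ → ℝ) : ℕ → ℕ∞
  | 0 => 0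
  | n + 1 => sInf {s : ℕ∞ | ∃ m : ℕ, s = m ∧ commTime Δ x n ≤ m ∧
      Δ ≤ walk x m - walk x (commTime Δ x n).toNat}

/-- The number of messages `N_t = max {n : τ_n < t}` (equal to `0` when `t = 0`). -/
def msgCount (Δ : ℝ) (x : ℕ → ℝ) (t : ℕ) : ℕ := sSup {n : ℕ | commTime Δ x n < t}

/-- The last communication time `τ(t) = τ_{N_t}`. -/
def lastComm (Δ : ℝ) (x : ℕ → ℝ) (t : ℕ) : ℕ := (commTime Δ x (msgCount Δ x t)).toNat

/-- The estimator `μ̂_t = Δ N_t / τ(t)` (equal to `0` before the first communication). -/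
def muHat (Δ : ℝ) (x : ℕ → ℝ) (t : ℕ) : ℝ := Δ * msgCount Δ x t / lastComm Δ x t

/-- The estimator `μ̌_t = Δ N_t / t`. -/
def muCheck (Δ : ℝ) (x : ℕ → ℝ) (t : ℕ) : ℝ := Δ * msgCount Δ x t / t

/-- The overshoot `η = S_{τ_1} - Δ` at the first communication time. -/
def overshoot (Δ : ℝ) (x : ℕ → ℝ) : ℝ := walk x (commTime Δ x 1).toNat - Δ

/-- The expected overshoot `E[η]` over the threshold `Δ` when the observations are i.i.d. with
law `P`. -/
def meanOvershoot (P : Measure ℝ) (Δ : ℝ) : ℝ :=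
  ∫ x, overshoot Δ x ∂(Measure.infinitePi fun _ : ℕ => P)

/-- The limiting average overshoot `lim_{Δ → ∞} E[η]` under the law `P`. -/
def limitOvershoot (P : Measure ℝ) : ℝ := limUnder atTop (meanOvershoot P)

/-- The overshoot correction `g(y) = y (1 + ρ(y) / Δ)`. -/
def correct (ρ : ℝ → ℝ) (Δ y : ℝ) : ℝ := y * (1 + ρ y / Δ)

/-- The law `P` is non-lattice: it is not carried by `dℤ`, for any `d > 0`. -/
def NonLattice (P : Measure ℝ) : Prop :=
  ∀ d : ℝ, 0 < d → ¬ ∀ᵐ x ∂P, ∃ n : ℤ, x = n * d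

/-- A family of non-lattice laws on `ℝ` with finite variance, parametrized by their mean
`θ ∈ (0, ∞)`. -/
structure IsMeanFamily (F : ℝ → Measure ℝ) : Prop where
  isProbabilityMeasure : ∀ θ, 0 < θ → IsProbabilityMeasure (F θ)
  memLp_two : ∀ θ, 0 < θ → MemLp id 2 (F θ)
  mean_eq : ∀ θ, 0 < θ → ∫ x, x ∂(F θ) = θ
  nonLattice : ∀ θ, 0 < θ → NonLattice (F θ)

/-- The limiting average overshoot as a function `ρ(θ)` of the mean. -/
def rho (F : ℝ → Measure ℝ) (θ : ℝ) : ℝ := limitOvershoot (F θ)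

/-- The moment, overshoot and Lipschitz conditions for the family `F` at the true mean `μ`. -/
structure OvershootConditions (F : ℝ → Measure ℝ) (μ : ℝ) : Prop where
  moment : ∃ r : ℝ, 2 ≤ r ∧ Integrable (fun x : ℝ => |x| ^ (r + 1)) (F μ)
  rate : ∃ r : ℝ, 2 ≤ r ∧
    (fun Δ : ℝ => meanOvershoot (F μ) Δ - rho F μ) =O[atTop] fun Δ : ℝ => Δ ^ (-(r - 1))
  lipschitz : ∃ C : ℝ≥0, LipschitzOnWith C (rho F) (Set.Ioi 0)

/-- The weights `w_k`, proportional to `σ_k⁻²` and summing to `1`. -/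
def weight {K : ℕ} (σ : Fin K → ℝ) (k : Fin K) : ℝ := (σ k ^ 2)⁻¹ / ∑ j, (σ j ^ 2)⁻¹

/-- The standard deviation, multiplied by `√t`, of the optimal linear estimator
`∑ k, w_k S_t^k / t` computed from all the observations. -/
def fusedSD {K : ℕ} (σ : Fin K → ℝ) : ℝ := √(∑ k, weight σ k ^ 2 * σ k ^ 2)

/-- `(Y n - μ) / (s / √(t n))` converges in distribution to `N(0, 1)`. -/
def AsympNormal {Ω : Type*} [MeasurableSpace Ω] (Pr : Measure Ω) [IsProbabilityMeasure Pr]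
    (Y : ℕ → Ω → ℝ) (μ s : ℝ) (t : ℕ → ℕ) : Prop :=
  TendstoInDistribution (fun n ω => (Y n ω - μ) / (s / √(t n : ℝ))) atTop
    (id : ℝ → ℝ) (fun _ => Pr) (gaussianReal 0 1)

end SensorFusion

end

/-! ### Paths, first passages and communication epochs. -/

namespace SensorFusion

/-! Fix one sensor and write `Z_n = S_n - μ n`, `T` for the last communication time before `t`, `N`
for the number of messages, `m` for the mean overshoot over `Δ`. By the strong Markov property
(`map_overshoot_restart`) the walk at the epochs is a sum of i.i.d. terms `Δ + η_i`. The second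
moment of `η` is `o(Δ)` (`exists_lintegral_sq_overshoot_le`) and `N = O(t/Δ)`, so Kolmogorov's
inequality gives `S_T = N (Δ + m) + o(√t)` in probability. The gap `t - T` is negligible against
every scale much larger than `Δ`, hence `Z_T = Z_t + o(√t)`. Together `N (Δ + m) = μ T + Z_t +
o(√t)`. Division by `T`, or by `t` when `Δ ≪ √t`, shows that the estimator multiplied by `1 + m/Δ`
is equivalent to the sample mean at scale `1/√t` (`tendsto_muHat_sub`, `tendsto_muCheck_sub`).

It remains to treat the factor `1 + m/Δ`. The mean overshoot is bounded
(`exists_lintegral_overshoot_le`), so if `√t ≪ Δ` the factor can be dropped. If only `t^{1/4} ≪ Δ`,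
then `√t/Δ² → 0`, and the rate of convergence of `m` and the Lipschitz property allow `m` to be
replaced by `ρ` evaluated at the estimator (`tendsto_scaled_correct`).

The fused estimators thus have the same limit as `∑ w_k S^k_t / t`, which obeys the central limit
theorem for the i.i.d. variables `∑ w_k X^k_i`. -/

/-- The path from time `n` on. -/
def shift (n : ℕ) (x : ℕ → ℝ) : ℕ → ℝ := fun i => x (i + n)

/-- The first time at which the walk reaches the level `a` (`0` if it never does). -/
noncomputable def hit (a : ℝ) (x : ℕ → ℝ) : ℕ := sInf {m | a ≤ walk x m}

/-- The path after the first passage over the level `a`. -/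
noncomputable def restart (a : ℝ) (x : ℕ → ℝ) : ℕ → ℝ := shift (hit a x) x

/-- The communication times, as natural numbers. -/
noncomputable def epoch (a : ℝ) (x : ℕ → ℝ) : ℕ → ℕ
  | 0 => 0
  | n + 1 => epoch a x n + hit a (shift (epoch a x n) x)

/-- The paths whose walk tends to `+∞`. -/
def driftPaths : Set (ℕ → ℝ) := {x | Tendsto (walk x) atTop atTop}

@[simp] lemma shift_apply (n : ℕ) (x : ℕ → ℝ) (i : ℕ) : shift n x i = x (i + n) := rfl

@[simp] lemma shift_zero (x : ℕ → ℝ) : shift 0 x = x := rfl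

lemma shift_shift (m n : ℕ) (x : ℕ → ℝ) : shift m (shift n x) = shift (n + m) x := by
  ext i; simp [add_assoc, add_comm m n]

@[simp] lemma walk_zero (x : ℕ → ℝ) : walk x 0 = 0 := by simp [walk]

lemma walk_add (x : ℕ → ℝ) (n m : ℕ) : walk x (n + m) = walk x n + walk (shift n x) m := by
  simp [walk, Finset.sum_range_add, add_comm]

lemma walk_succ (x : ℕ → ℝ) (m : ℕ) : walk x (m + 1) = x 0 + walk (shift 1 x) m := by
  rw [add_comm m 1, walk_add]; simp [walk]

lemma shift_mem_driftPaths {x : ℕ → ℝ} (hx : x ∈ driftPaths) (n : ℕ) :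
    shift n x ∈ driftPaths := by
  have h : Tendsto (fun m => walk x (n + m)) atTop atTop :=
    hx.comp (tendsto_add_atTop_nat n |>.congr fun m => add_comm m n)
  have := tendsto_atTop_add_const_right _ (-walk x n) h
  refine this.congr fun m => ?_
  rw [walk_add]; ring

lemma exists_le_walk {x : ℕ → ℝ} (hx : x ∈ driftPaths) (a : ℝ) : ∃ m, a ≤ walk x m :=
  (hx.eventually_ge_atTop a).exists

lemma le_walk_hit {a : ℝ} {x : ℕ → ℝ} (h : ∃ m, a ≤ walk x m) : a ≤ walk x (hit a x) :=
  Nat.sInf_mem (s := {m | a ≤ walk x m}) h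

lemma walk_lt_of_lt_hit {a : ℝ} {x : ℕ → ℝ} {m : ℕ} (h : m < hit a x) : walk x m < a :=
  not_le.1 (Nat.notMem_of_lt_sInf (s := {m | a ≤ walk x m}) h)

lemma hit_le {a : ℝ} {x : ℕ → ℝ} {m : ℕ} (h : a ≤ walk x m) : hit a x ≤ m :=
  Nat.sInf_le (s := {m | a ≤ walk x m}) h

lemma hit_of_nonpos {a : ℝ} (ha : a ≤ 0) (x : ℕ → ℝ) : hit a x = 0 :=
  Nat.le_zero.1 (hit_le (by simpa using ha))

lemma hit_pos {a : ℝ} (ha : 0 < a) {x : ℕ → ℝ} (h : ∃ m, a ≤ walk x m) : 0 < hit a x := by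
  refine Nat.pos_of_ne_zero fun h0 => ?_
  have := le_walk_hit h
  rw [h0, walk_zero] at this
  exact absurd this (not_le.2 ha)

lemma hit_eq_succ {a : ℝ} (ha : 0 < a) {x : ℕ → ℝ} (h : ∃ m, a ≤ walk x m) :
    hit a x = hit (a - x 0) (shift 1 x) + 1 := by
  obtain ⟨k, hk⟩ := Nat.exists_eq_succ_of_ne_zero (hit_pos ha h).ne'
  have hk' : a - x 0 ≤ walk (shift 1 x) k := by
    have := le_walk_hit h
    rw [hk, Nat.succ_eq_add_one, walk_succ] at this
    linarith
  refine le_antisymm (hit_le ?_) ?_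
  · rw [walk_succ]; linarith [le_walk_hit ⟨k, hk'⟩]
  · rw [hk]; exact Nat.succ_le_succ (hit_le hk')

/-- Valid on every path: if the level is never reached, the infimum is `⊤` in `ℕ∞`, which `toNat`
sends to `0`, the value of `sInf ∅` in `ℕ`. -/
lemma commTime_one_toNat (a : ℝ) (x : ℕ → ℝ) : (commTime a x 1).toNat = hit a x := by
  have hset : {s : ℕ∞ | ∃ m : ℕ, s = m ∧ commTime a x 0 ≤ m ∧
      a ≤ walk x m - walk x (commTime a x 0).toNat} = (fun m : ℕ => (m : ℕ∞)) '' {m | a ≤ walk x m} := by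
    ext s
    simp [commTime, and_comm, eq_comm]
  rw [commTime, hset]
  by_cases h : ∃ m, a ≤ walk x m
  · have : sInf ((fun m : ℕ => (m : ℕ∞)) '' {m | a ≤ walk x m}) = (hit a x : ℕ) := by
      refine le_antisymm (sInf_le ⟨_, le_walk_hit h, rfl⟩) (le_sInf ?_)
      rintro _ ⟨m, hm, rfl⟩
      exact Nat.cast_le.2 (hit_le hm)
    rw [this]; simp
  · have h' : {m | a ≤ walk x m} = ∅ := by
      ext m; simpa using not_le.1 fun hm => h ⟨m, hm⟩
    simp [hit, h']

lemma overshoot_eq (a : ℝ) (x : ℕ → ℝ) : overshoot a x = walk x (hit a x) - a := by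
  rw [overshoot, commTime_one_toNat]

lemma overshoot_nonneg (a : ℝ) {x : ℕ → ℝ} (hx : x ∈ driftPaths) : 0 ≤ overshoot a x := by
  rw [overshoot_eq]; linarith [le_walk_hit (exists_le_walk hx a)]

lemma commTime_eq_epoch (a : ℝ) {x : ℕ → ℝ} (hx : x ∈ driftPaths) (n : ℕ) :
    commTime a x n = (epoch a x n : ℕ) := by
  induction n with
  | zero => simp [commTime, epoch]
  | succ n ih =>
    rw [commTime, ih, epoch]
    have hn := shift_mem_driftPaths hx (epoch a x n)
    refine le_antisymm (sInf_le ⟨_, rfl, ?_, ?_⟩) (le_sInf ?_)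
    · exact_mod_cast Nat.le_add_right _ _
    · rw [walk_add]; simpa using le_walk_hit (exists_le_walk hn a)
    · rintro _ ⟨m, rfl, hm, ham⟩
      obtain ⟨j, rfl⟩ := Nat.exists_eq_add_of_le (Nat.cast_le.1 hm)
      rw [walk_add] at ham
      exact Nat.cast_le.2 (Nat.add_le_add_left (hit_le (by simpa using ham)) _)

lemma restart_iterate (a : ℝ) (x : ℕ → ℝ) (n : ℕ) :
    (restart a)^[n] x = shift (epoch a x n) x := by
  induction n with
  | zero => simp [epoch]
  | succ n ih => rw [Function.iterate_succ_apply', ih, restart, shift_shift, epoch]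

/-- Between consecutive epochs the walk gains the threshold plus an overshoot, and the successive
overshoots are one functional evaluated along the orbit of `restart a`. This is the form to which
the maximal inequality for iterates applies. -/
lemma walk_epoch (a : ℝ) (x : ℕ → ℝ) (n : ℕ) :
    walk x (epoch a x n) = ∑ i ∈ Finset.range n, (overshoot a ((restart a)^[i] x) + a) := by
  induction n with
  | zero => simp [epoch]
  | succ n ih =>
    rw [epoch, walk_add, ih, Finset.sum_range_succ, overshoot_eq, restart_iterate]
    ring

lemma mul_le_walk_epoch (a : ℝ) {x : ℕ → ℝ} (hx : x ∈ driftPaths) (n : ℕ) :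
    a * n ≤ walk x (epoch a x n) := by
  rw [walk_epoch]
  calc a * n = ∑ i ∈ Finset.range n, a := by simp [mul_comm]
    _ ≤ _ := Finset.sum_le_sum fun i _ => by
      rw [restart_iterate]
      linarith [overshoot_nonneg a (shift_mem_driftPaths hx (epoch a x i))]

lemma strictMono_epoch {a : ℝ} (ha : 0 < a) {x : ℕ → ℝ} (hx : x ∈ driftPaths) :
    StrictMono (epoch a x) :=
  strictMono_nat_of_lt_succ fun n => by
    rw [epoch]
    have := hit_pos ha (exists_le_walk (shift_mem_driftPaths hx (epoch a x n)) a)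
    omega

lemma walk_sub_lt_of_lt_epoch {a : ℝ} {x : ℕ → ℝ} {n m : ℕ} (h1 : epoch a x n ≤ m)
    (h2 : m < epoch a x (n + 1)) : walk x m - walk x (epoch a x n) < a := by
  obtain ⟨j, rfl⟩ := Nat.exists_eq_add_of_le h1
  rw [epoch] at h2
  rw [walk_add]
  have := walk_lt_of_lt_hit (a := a) (x := shift (epoch a x n) x) (m := j) (by omega)
  linarith

lemma lastComm_eq_epoch (a : ℝ) {x : ℕ → ℝ} (hx : x ∈ driftPaths) (t : ℕ) :
    lastComm a x t = epoch a x (msgCount a x t) := by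
  rw [lastComm, commTime_eq_epoch a hx]; simp

lemma msgCount_spec {a : ℝ} (ha : 0 < a) {x : ℕ → ℝ} (hx : x ∈ driftPaths) {t : ℕ} (ht : 0 < t) :
    epoch a x (msgCount a x t) < t ∧ t ≤ epoch a x (msgCount a x t + 1) := by
  have hset : {n : ℕ | commTime a x n < t} = {n | epoch a x n < t} := by
    ext n; simp [commTime_eq_epoch a hx]
  have hbdd : BddAbove {n | epoch a x n < t} :=
    ⟨t, fun n hn => ((strictMono_epoch ha hx).le_apply.trans_lt hn).le⟩
  have hne : {n | epoch a x n < t}.Nonempty := ⟨0, by simpa [epoch] using ht⟩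
  rw [msgCount, hset]
  refine ⟨Nat.sSup_mem hne hbdd, not_lt.1 fun h => ?_⟩
  have := le_csSup hbdd h
  omega

/-! ### Measurability -/

@[fun_prop] lemma measurable_walk (n : ℕ) : Measurable fun x : ℕ → ℝ => walk x n := by
  unfold walk; fun_prop

@[fun_prop] lemma measurable_shift (n : ℕ) : Measurable (shift n) := by
  unfold shift; fun_prop

lemma measurable_sInf_nat {E : Type*} [MeasurableSpace E] {p : ℕ → E → Prop}
    (hp : ∀ n, MeasurableSet {x | p n x}) : Measurable fun x => sInf {n | p n x} := by
  refine measurable_to_countable' fun n => ?_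
  -- The last set accounts for `sInf ∅ = 0`.
  have : (fun x => sInf {n | p n x}) ⁻¹' {n} =
      ({x | p n x} ∩ ⋂ m ∈ Set.Iio n, {x | p m x}ᶜ) ∪ {x | n = 0 ∧ ∀ m, x ∈ {x | p m x}ᶜ} := by
    ext x
    simp only [Set.mem_preimage, Set.mem_singleton_iff, Set.mem_union, Set.mem_inter_iff,
      Set.mem_ofPred_eq, Set.mem_iInter, Set.mem_Iio, Set.mem_compl_iff]
    constructor
    · rintro rfl
      by_cases h : ∃ m, p m x
      · exact Or.inl ⟨Nat.sInf_mem (s := {n | p n x}) h,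
          fun m hm => Nat.notMem_of_lt_sInf (s := {n | p n x}) hm⟩
      · have h' := not_exists.1 h
        refine Or.inr ⟨?_, h'⟩
        simp [h']
    · rintro (⟨h1, h2⟩ | ⟨rfl, h⟩)
      · exact le_antisymm (Nat.sInf_le h1) (not_lt.1 fun hlt =>
          h2 _ hlt (Nat.sInf_mem (s := {n | p n x}) ⟨n, h1⟩))
      · simp [h]
  rw [this]
  refine ((hp n).inter (MeasurableSet.biInter (Set.to_countable _) fun m _ => (hp m).compl)).union ?_
  by_cases hn : n = 0
  · simp only [hn, true_and]
    simp_rw [Set.ofPred_forall]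
    exact MeasurableSet.iInter fun m => (hp m).compl
  · simp [hn]

lemma measurable_hit (a : ℝ) : Measurable (hit a) :=
  measurable_sInf_nat fun n => measurableSet_le measurable_const (measurable_walk n)

lemma measurable_apply_nat {E F : Type*} [MeasurableSpace E] [MeasurableSpace F] {f : ℕ → E → F}
    (hf : ∀ n, Measurable (f n)) {g : E → ℕ} (hg : Measurable g) :
    Measurable fun x => f (g x) x :=
  (measurable_from_prod_countable_right (f := fun p : ℕ × E => f p.1 p.2) hf).comp
    (hg.prodMk measurable_id)

lemma measurable_restart (a : ℝ) : Measurable (restart a) :=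
  measurable_apply_nat measurable_shift (measurable_hit a)

lemma measurable_overshoot (a : ℝ) : Measurable (overshoot a) := by
  have : overshoot a = fun x => walk x (hit a x) - a := funext (overshoot_eq a)
  rw [this]
  exact (measurable_apply_nat (f := fun n x => walk x n) measurable_walk
    (measurable_hit a)).sub_const a

lemma measurable_epoch (a : ℝ) (n : ℕ) : Measurable fun x => epoch a x n := by
  induction n with
  | zero => exact measurable_const
  | succ n ih =>
    exact ih.add ((measurable_hit a).comp (measurable_apply_nat measurable_shift ih))

/-! ### Functionals of the first passage -/

/-- `F` of the overshoot over `p.1` and of the path after the passage if the passage happens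
by time `n`, and `0` otherwise, as a recursion on the first step of the walk. -/
noncomputable def passage (F : ℝ × (ℕ → ℝ) → ℝ≥0∞) : ℕ → ℝ × (ℕ → ℝ) → ℝ≥0∞
  | 0, p => if p.1 ≤ 0 then F (-p.1, p.2) else 0
  | n + 1, p => if p.1 ≤ 0 then F (-p.1, p.2) else passage F n (p.1 - p.2 0, shift 1 p.2)

lemma passage_of_nonpos (F : ℝ × (ℕ → ℝ) → ℝ≥0∞) (n : ℕ) {a : ℝ} (ha : a ≤ 0) (x : ℕ → ℝ) :
    passage F n (a, x) = F (-a, x) := by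
  cases n <;> simp [passage, ha]

lemma passage_succ_of_pos (F : ℝ × (ℕ → ℝ) → ℝ≥0∞) (n : ℕ) {a : ℝ} (ha : 0 < a) (x : ℕ → ℝ) :
    passage F (n + 1) (a, x) = passage F n (a - x 0, shift 1 x) := by
  simp [passage, ha]

lemma measurable_passage {F : ℝ × (ℕ → ℝ) → ℝ≥0∞} (hF : Measurable F) (n : ℕ) :
    Measurable (passage F n) := by
  have h1 : Measurable fun p : ℝ × (ℕ → ℝ) => F (-p.1, p.2) := by fun_prop
  have h2 : MeasurableSet {p : ℝ × (ℕ → ℝ) | p.1 ≤ 0} :=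
    measurableSet_le measurable_fst measurable_const
  induction n with
  | zero => exact Measurable.ite h2 h1 measurable_const
  | succ n ih => exact Measurable.ite h2 h1 (ih.comp (by fun_prop))

open Classical in
-- Removing the first step lowers the level to `a - x 0` and changes neither the overshoot nor the
-- path after the passage, by `hit_eq_succ`. A level `a ≤ 0` is passed at time `0` with overshoot
-- `-a`.
lemma passage_eq (F : ℝ × (ℕ → ℝ) → ℝ≥0∞) (n : ℕ) (a : ℝ) (x : ℕ → ℝ) :
    passage F n (a, x) =
      if ∃ m ≤ n, a ≤ walk x m then F (overshoot a x, restart a x) else 0 := by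
  induction n generalizing a x with
  | zero =>
    by_cases ha : a ≤ 0
    · simp [passage, ha, overshoot_eq, hit_of_nonpos, restart]
    · simp [passage, ha]
  | succ n ih =>
    by_cases ha : a ≤ 0
    · have : ∃ m ≤ n + 1, a ≤ walk x m := ⟨0, by simp, by simpa using ha⟩
      rw [passage_of_nonpos F _ ha, if_pos this]
      simp [overshoot_eq, hit_of_nonpos ha, restart]
    · have ha' := not_le.1 ha
      rw [passage_succ_of_pos F n ha', ih]
      have hiff : (∃ m ≤ n, a - x 0 ≤ walk (shift 1 x) m) ↔ ∃ m ≤ n + 1, a ≤ walk x m := by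
        constructor
        · rintro ⟨m, hm, h⟩
          exact ⟨m + 1, by omega, by rw [walk_succ]; linarith⟩
        · rintro ⟨_ | m, hm, h⟩
          · simp at h; exact absurd h ha
          · exact ⟨m, by omega, by rw [walk_succ] at h; linarith⟩
      by_cases h : ∃ m ≤ n + 1, a ≤ walk x m
      · rw [if_pos h, if_pos (hiff.2 h)]
        obtain ⟨m, -, hm⟩ := h
        have e := hit_eq_succ ha' ⟨m, hm⟩
        rw [overshoot_eq, overshoot_eq, restart, restart, shift_shift, e, walk_succ]
        congr 2
        · ring
        · rw [add_comm]
      · rw [if_neg h, if_neg (hiff.not.2 h)]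

lemma monotone_passage (F : ℝ × (ℕ → ℝ) → ℝ≥0∞) (p : ℝ × (ℕ → ℝ)) :
    Monotone fun n => passage F n p := by
  classical
  refine monotone_nat_of_le_succ fun n => ?_
  obtain ⟨a, x⟩ := p
  simp only [passage_eq]
  by_cases h : ∃ m ≤ n, a ≤ walk x m
  · have h' : ∃ m ≤ n + 1, a ≤ walk x m := h.imp fun m hm => ⟨by omega, hm.2⟩
    rw [if_pos h, if_pos h']
  · rw [if_neg h]; exact zero_le

lemma tendsto_passage (F : ℝ × (ℕ → ℝ) → ℝ≥0∞) (a : ℝ) {x : ℕ → ℝ} (hx : x ∈ driftPaths) :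
    Tendsto (fun n => passage F n (a, x)) atTop (𝓝 (F (overshoot a x, restart a x))) := by
  classical
  obtain ⟨m, hm⟩ := exists_le_walk hx a
  refine tendsto_const_nhds.congr' ?_
  filter_upwards [eventually_ge_atTop m] with n hn
  rw [passage_eq, if_pos ⟨m, hn, hm⟩]

end SensorFusion

/-! ### I.i.d. paths: law of large numbers and strong Markov property. -/

namespace SensorFusion

/-- The law of a path of i.i.d. observations with law `P`. -/
noncomputable abbrev pathLaw (P : Measure ℝ) : Measure (ℕ → ℝ) := Measure.infinitePi fun _ => P

section

variable {P : Measure ℝ} [IsProbabilityMeasure P]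

lemma map_shift_pathLaw (n : ℕ) : (pathLaw P).map (shift n) = pathLaw P :=
  Measure.map_infinitePi_infinitePi_of_inj (P := fun _ : ℕ => P) (add_left_injective n)

lemma map_eval_pathLaw (i : ℕ) : (pathLaw P).map (fun x => x i) = P :=
  Measure.infinitePi_map_eval (fun _ => P) i

lemma iIndepFun_eval_pathLaw : iIndepFun (fun i (x : ℕ → ℝ) => x i) (pathLaw P) :=
  iIndepFun_infinitePi (X := fun _ y => y) (by fun_prop)

lemma identDistrib_eval_pathLaw (i j : ℕ) :
    IdentDistrib (fun x : ℕ → ℝ => x i) (fun x => x j) (pathLaw P) (pathLaw P) where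
  aemeasurable_fst := (measurable_pi_apply i).aemeasurable
  aemeasurable_snd := (measurable_pi_apply j).aemeasurable
  map_eq := by rw [map_eval_pathLaw, map_eval_pathLaw]

/-- The Markov property at time `1`. -/
lemma map_first_shift :
    (pathLaw P).map (fun x => (x 0, shift 1 x)) = P.prod (pathLaw P) := by
  have hm : Measurable fun x : ℕ → ℝ => (x 0, shift 1 x) := by fun_prop
  have h := indep_iSup_of_disjoint (S := {0}) (T := {i | 1 ≤ i})
    (fun i => (measurable_pi_apply (X := fun _ : ℕ => ℝ) i).comap_le)
    (iIndepFun_eval_pathLaw (P := P)) (by simp)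
  have hind : IndepFun (fun x : ℕ → ℝ => x 0) (shift 1) (pathLaw P) := by
    refine indep_of_indep_of_le_left (indep_of_indep_of_le_right h ?_) ?_
    · refine measurable_iff_comap_le.1 ((@measurable_pi_iff _ _ _ (_) _ _).2 fun i => ?_)
      refine measurable_iff_comap_le.2 ?_
      exact le_iSup₂_of_le (f := fun (i : ℕ) (_ : i ∈ {i | 1 ≤ i}) =>
        MeasurableSpace.comap (fun x : ℕ → ℝ => x i) Real.measurableSpace) (i + 1) (by simp) le_rfl
    · exact le_iSup₂_of_le 0 (by simp) le_rfl
  rw [(indepFun_iff_map_prod_eq_prod_map_map (measurable_pi_apply 0).aemeasurable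
    (measurable_shift 1).aemeasurable).1 hind,
    map_eval_pathLaw, map_shift_pathLaw]

lemma lintegral_first_shift {f : ℝ × (ℕ → ℝ) → ℝ≥0∞} (hf : Measurable f) :
    ∫⁻ x, f (x 0, shift 1 x) ∂(pathLaw P) = ∫⁻ y, ∫⁻ x, f (y, x) ∂(pathLaw P) ∂P := by
  rw [← lintegral_prod _ hf.aemeasurable, ← map_first_shift, lintegral_map hf (by fun_prop)]

lemma ae_tendsto_walk_div (hi : Integrable id P) :
    ∀ᵐ x ∂(pathLaw P), Tendsto (fun n : ℕ => walk x n / n) atTop (𝓝 (∫ y, y ∂P)) := by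
  have h0 : Integrable (fun x : ℕ → ℝ => x 0) (pathLaw P) := by
    have := hi
    rw [← map_eval_pathLaw (P := P) 0] at this
    exact this.comp_measurable (by fun_prop)
  have := strong_law_ae_real (μ := pathLaw P) (fun i x => x i) h0
    (fun i j hij => iIndepFun_eval_pathLaw.indepFun hij) (fun i => identDistrib_eval_pathLaw i 0)
  have hE : ∫ x : ℕ → ℝ, x 0 ∂(pathLaw P) = ∫ y, y ∂P := by
    conv_rhs => rw [← map_eval_pathLaw (P := P) 0]
    rw [integral_map (measurable_pi_apply 0).aemeasurable (by fun_prop)]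
  rw [hE] at this
  exact this

lemma ae_mem_driftPaths (hi : Integrable id P) (hpos : 0 < ∫ y, y ∂P) :
    ∀ᵐ x ∂(pathLaw P), x ∈ driftPaths := by
  filter_upwards [ae_tendsto_walk_div hi] with x hx
  have h := Tendsto.pos_mul_atTop hpos hx (tendsto_natCast_atTop_atTop (R := ℝ))
  refine h.congr' ?_
  filter_upwards [eventually_ne_atTop 0] with n hn
  have : (n : ℝ) ≠ 0 := by exact_mod_cast hn
  field_simp

lemma lintegral_passage_succ {F : ℝ × (ℕ → ℝ) → ℝ≥0∞} (hF : Measurable F) (n : ℕ) {a : ℝ}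
    (ha : 0 < a) : ∫⁻ x, passage F (n + 1) (a, x) ∂(pathLaw P) =
      ∫⁻ y, ∫⁻ x, passage F n (a - y, x) ∂(pathLaw P) ∂P := by
  have hm := measurable_passage hF n
  rw [← lintegral_first_shift (f := fun q => passage F n (a - q.1, q.2))
    (hm.comp (by fun_prop))]
  simp_rw [passage_succ_of_pos F n ha]

/-- This is the strong Markov property for passages within `n` steps: the path after the passage may
be averaged out separately. At a nonpositive level the whole path is still fresh; at a positive
level one step is integrated out and the induction hypothesis applies at the new level. -/
lemma lintegral_passage_eq {F : ℝ × (ℕ → ℝ) → ℝ≥0∞} (hF : Measurable F) (n : ℕ) (a : ℝ) :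
    ∫⁻ x, passage F n (a, x) ∂(pathLaw P) =
      ∫⁻ x, passage (fun p => ∫⁻ z, F (p.1, z) ∂(pathLaw P)) n (a, x) ∂(pathLaw P) := by
  have hG : Measurable fun p : ℝ × (ℕ → ℝ) => ∫⁻ z, F (p.1, z) ∂(pathLaw P) := by
    have : Measurable fun c : ℝ => ∫⁻ z, F (c, z) ∂(pathLaw P) := hF.lintegral_prod_right'
    exact this.comp measurable_fst
  induction n generalizing a with
  | zero =>
    by_cases ha : a ≤ 0
    · simp [passage, ha]
    · simp [passage, ha]
  | succ n ih =>
    by_cases ha : a ≤ 0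
    · simp [passage_of_nonpos _ _ ha]
    · rw [lintegral_passage_succ hF n (not_le.1 ha), lintegral_passage_succ hG n (not_le.1 ha)]
      simp_rw [ih]

lemma tendsto_lintegral_passage (hi : Integrable id P) (hpos : 0 < ∫ y, y ∂P)
    {F : ℝ × (ℕ → ℝ) → ℝ≥0∞} (hF : Measurable F) (a : ℝ) :
    Tendsto (fun n => ∫⁻ x, passage F n (a, x) ∂(pathLaw P)) atTop
      (𝓝 (∫⁻ x, F (overshoot a x, restart a x) ∂(pathLaw P))) := by
  refine lintegral_tendsto_of_tendsto_of_monotone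
    (fun n => ((measurable_passage hF n).comp (by fun_prop)).aemeasurable)
    (ae_of_all _ fun x => monotone_passage F (a, x)) ?_
  filter_upwards [ae_mem_driftPaths hi hpos] with x hx using tendsto_passage F a hx

/-- The strong Markov property at the first passage over the level `a`. -/
theorem map_overshoot_restart (hi : Integrable id P) (hpos : 0 < ∫ y, y ∂P) (a : ℝ) :
    (pathLaw P).map (fun x => (overshoot a x, restart a x)) =
      ((pathLaw P).map (overshoot a)).prod (pathLaw P) := by
  have hm : Measurable fun x => (overshoot a x, restart a x) :=
    (measurable_overshoot a).prodMk (measurable_restart a)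
  have : IsProbabilityMeasure ((pathLaw P).map (overshoot a)) :=
    Measure.isProbabilityMeasure_map (measurable_overshoot a).aemeasurable
  refine Measure.ext_of_lintegral _ fun F hF => ?_
  have hG' : Measurable fun c : ℝ => ∫⁻ z, F (c, z) ∂(pathLaw P) := hF.lintegral_prod_right'
  have hG : Measurable fun p : ℝ × (ℕ → ℝ) => ∫⁻ z, F (p.1, z) ∂(pathLaw P) :=
    hG'.comp measurable_fst
  rw [lintegral_map hF hm, lintegral_prod _ hF.aemeasurable, lintegral_map hG'
    (measurable_overshoot a)]
  have h1 := tendsto_lintegral_passage hi hpos hF a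
  have h2 := tendsto_lintegral_passage hi hpos hG a
  simp_rw [lintegral_passage_eq hF] at h1
  exact tendsto_nhds_unique h1 h2

/-- A function `u` that dominates its own first-step recursion dominates the expectation of `φ`
of the overshoot. -/
theorem lintegral_overshoot_le (hi : Integrable id P) (hpos : 0 < ∫ y, y ∂P) {φ u : ℝ → ℝ≥0∞}
    (hφ : Measurable φ)
    (h : ∀ a, 0 < a → ∫⁻ y, (if a ≤ y then φ (y - a) else u (a - y)) ∂P ≤ u a)
    {a : ℝ} (ha : 0 < a) : ∫⁻ x, φ (overshoot a x) ∂(pathLaw P) ≤ u a := by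
  have hF : Measurable fun p : ℝ × (ℕ → ℝ) => φ p.1 := hφ.comp measurable_fst
  -- The bound by `u` is proved for passages within `n` steps, starting from `0` at `n = 0`, and
  -- survives the monotone limit.
  refine le_of_tendsto' (tendsto_lintegral_passage hi hpos hF a) fun n => ?_
  induction n generalizing a with
  | zero => simp [passage, not_le.2 ha]
  | succ n ih =>
    rw [lintegral_passage_succ hF n ha]
    refine (lintegral_mono fun y => ?_).trans (h a ha)
    dsimp only
    split_ifs with hy
    · simp [passage_of_nonpos _ n (sub_nonpos.2 hy)]
    · exact ih (sub_pos.2 (not_le.1 hy))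

end

end SensorFusion

/-! ### Moment bounds for the overshoot. -/

namespace SensorFusion

section

variable {P : Measure ℝ}

lemma tendsto_integral_sq_indicator (h2 : MemLp id 2 P) :
    Tendsto (fun n : ℕ => ∫ y, (Set.Ioi (n : ℝ)).indicator (fun y => y ^ 2) y ∂P) atTop (𝓝 0) := by
  have := tendsto_integral_of_dominated_convergence (μ := P) (f := fun _ => (0 : ℝ))
    (F := fun (n : ℕ) y => (Set.Ioi (n : ℝ)).indicator (fun y => y ^ 2) y) (fun y => y ^ 2)
    (fun n => ((measurable_id.pow_const 2).indicator measurableSet_Ioi).aestronglyMeasurable)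
    h2.integrable_sq (fun n => ae_of_all _ fun y => ?_) (ae_of_all _ fun y => ?_)
  · simpa using this
  · refine (norm_indicator_le_norm_self _ _).trans ?_
    simp
  · refine tendsto_const_nhds.congr' ?_
    obtain ⟨m, hm⟩ := exists_nat_ge y
    filter_upwards [eventually_ge_atTop m] with n hn
    rw [Set.indicator_of_notMem]
    have : (m : ℝ) ≤ n := by exact_mod_cast hn
    simpa using hm.trans this

/-- The stop-loss transform `E (Y - a)⁺` of a law. -/
noncomputable def stopLoss (P : Measure ℝ) (a : ℝ) : ℝ := ∫ y, max (y - a) 0 ∂P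

lemma stopLoss_nonneg (a : ℝ) : 0 ≤ stopLoss P a :=
  integral_nonneg fun _ => le_max_right _ _

lemma continuousOn_stopLoss (hi : Integrable id P) : ContinuousOn (stopLoss P) (Set.Ici 0) := by
  refine continuousOn_of_dominated (bound := fun y => |y|) (fun a _ => by fun_prop) ?_ hi.abs ?_
  · refine fun a ha => ae_of_all _ fun y => ?_
    rw [Real.norm_eq_abs, abs_of_nonneg (le_max_right _ _)]
    exact max_le (by linarith [le_abs_self y, Set.mem_Ici.1 ha]) (abs_nonneg y)
  · exact ae_of_all _ fun y => by fun_prop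

variable [IsProbabilityMeasure P]

lemma lintegral_le_ofReal {E : Type*} [MeasurableSpace E] {Q : Measure E} {f : E → ℝ≥0∞}
    {h : E → ℝ} {c : ℝ} (hi : Integrable h Q) (h0 : ∀ y, 0 ≤ h y)
    (hf : ∀ y, f y ≤ ENNReal.ofReal (h y)) (hc : ∫ y, h y ∂Q ≤ c) :
    ∫⁻ y, f y ∂Q ≤ ENNReal.ofReal c := by
  refine (lintegral_mono hf).trans ?_
  rw [← ofReal_integral_eq_lintegral_ofReal hi (ae_of_all _ h0)]
  exact ENNReal.ofReal_le_ofReal hc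

lemma integrable_id_of_memLp (h2 : MemLp id 2 P) : Integrable id P :=
  h2.integrable (by norm_num)

lemma integrable_min_const (hi : Integrable id P) (c : ℝ) : Integrable (fun y => min y c) P :=
  hi.inf (integrable_const c)

lemma tendsto_integral_min (hi : Integrable id P) :
    Tendsto (fun n : ℕ => ∫ y, min y (n : ℝ) ∂P) atTop (𝓝 (∫ y, y ∂P)) := by
  refine tendsto_integral_of_dominated_convergence (fun y => |y|)
    (fun n => (integrable_min_const hi n).aestronglyMeasurable) hi.abs
    (fun n => ae_of_all _ fun y => ?_) (ae_of_all _ fun y => ?_)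
  · have : (0 : ℝ) ≤ n := n.cast_nonneg
    rw [Real.norm_eq_abs]
    rcases le_total y n with h | h
    · rw [min_eq_left h]
    · rw [min_eq_right h, abs_of_nonneg this]; exact h.trans (le_abs_self y)
  · refine tendsto_const_nhds.congr' ?_
    obtain ⟨m, hm⟩ := exists_nat_ge y
    filter_upwards [eventually_ge_atTop m] with n hn
    have : (m : ℝ) ≤ n := by exact_mod_cast hn
    rw [min_eq_left (hm.trans this)]

/-- The second moment of the overshoot over the level `a` is `o(a)`. -/
theorem exists_lintegral_sq_overshoot_le (h2 : MemLp id 2 P) (hpos : 0 < ∫ y, y ∂P) {ε : ℝ}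
    (hε : 0 < ε) : ∃ A : ℝ, 0 ≤ A ∧ ∀ a, 0 < a →
      ∫⁻ x, ENNReal.ofReal (overshoot a x ^ 2) ∂(pathLaw P) ≤ ENNReal.ofReal (A + ε * a) := by
  have hi := integrable_id_of_memLp h2
  set μ := ∫ y, y ∂P with hμ
  have e1 := (tendsto_integral_sq_indicator h2).eventually_le_const
    (show (0 : ℝ) < ε * (μ / 2) by positivity)
  have e2 := (tendsto_integral_min hi).eventually_const_le (show μ / 2 < ∫ y, y ∂P by linarith)
  -- The truncation level `k` makes `E[Y²; Y > k] ≤ ε μ / 2` and `E min(Y, k) ≥ μ / 2`. In one step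
  -- the linear term of `u` then loses at least `ε μ / 2` on average, which pays for the tail of the
  -- squared jump.
  obtain ⟨n, h1, h2'⟩ := (e1.and e2).exists
  set k : ℝ := (n : ℝ) with hkn
  have hk : 0 ≤ k := n.cast_nonneg
  set J : ℝ → ℝ := (Set.Ioi k).indicator fun y => y ^ 2 with hJ
  have hJ0 : ∀ y, 0 ≤ J y := fun y => Set.indicator_nonneg (fun y _ => sq_nonneg y) y
  have hJi : Integrable J P := (h2.integrable_sq).indicator measurableSet_Ioi
  have hmi := integrable_min_const hi k
  refine ⟨k ^ 2 + ε * k, by positivity, fun a ha => ?_⟩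
  have key := lintegral_overshoot_le hi hpos (φ := fun c => ENNReal.ofReal (c ^ 2))
    (u := fun a => ENNReal.ofReal (k ^ 2 + ε * (a + k))) (by fun_prop) ?_ ha
  · exact key.trans (ENNReal.ofReal_le_ofReal (by linarith))
  intro a ha
  -- Replacing `y` by `min y k` only increases the bound, and keeps it nonnegative also for the
  -- jumps that cross the level.
  have hmin : ∀ y : ℝ, 0 ≤ a - min y k + k := fun y => by linarith [min_le_right y k]
  have i1 : Integrable (fun y => k ^ 2 + J y) P := (integrable_const _).add hJi
  have i2 : Integrable (fun y => a - min y k) P := (integrable_const a).sub hmi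
  have i3 : Integrable (fun y => a - min y k + k) P := i2.add (integrable_const k)
  refine lintegral_le_ofReal (h := fun y => (k ^ 2 + J y) + ε * (a - min y k + k))
    (i1.add (i3.const_mul ε)) ?_ ?_ ?_
  · intro y
    have := hJ0 y; have := hmin y; positivity
  · intro y
    split_ifs with hy
    · refine ENNReal.ofReal_le_ofReal ?_
      have h3 : (y - a) ^ 2 ≤ y ^ 2 := by nlinarith
      have h4 : y ^ 2 ≤ k ^ 2 + J y := by
        rcases le_or_gt y k with h | h
        · have := hJ0 y; nlinarith
        · rw [hJ, Set.indicator_of_mem (Set.mem_Ioi.2 h)]; nlinarith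
      have := mul_nonneg hε.le (hmin y)
      linarith
    · refine ENNReal.ofReal_le_ofReal ?_
      have h3 : ε * (a - y + k) ≤ ε * (a - min y k + k) :=
        mul_le_mul_of_nonneg_left (by linarith [min_le_left y k]) hε.le
      linarith [hJ0 y]
  · rw [integral_add i1 (i3.const_mul ε), integral_add (integrable_const _) hJi,
      integral_const_mul, integral_add i2 (integrable_const k), integral_sub (integrable_const a) hmi]
    simp only [integral_const, probReal_univ, one_smul]
    nlinarith

lemma integrable_posPart_sub (hi : Integrable id P) (a : ℝ) :
    Integrable (fun y => max (y - a) 0) P :=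
  (hi.sub (integrable_const a)).pos_part

lemma integrable_posPart_sub_sq (h2 : MemLp id 2 P) (a : ℝ) :
    Integrable (fun y => (max (y - a) 0) ^ 2) P := by
  have h : MemLp (fun y => y - a) 2 P := h2.sub (memLp_const a)
  refine h.integrable_sq.mono' (by fun_prop) (ae_of_all _ fun y => ?_)
  rw [Real.norm_eq_abs, abs_of_nonneg (sq_nonneg _)]
  rcases le_total (y - a) 0 with h | h
  · rw [max_eq_right h]; nlinarith [sq_nonneg (y - a)]
  · rw [max_eq_left h]

lemma antitone_stopLoss (hi : Integrable id P) : Antitone (stopLoss P) := fun a b hab =>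
  integral_mono (integrable_posPart_sub hi b) (integrable_posPart_sub hi a)
    fun y => max_le_max_right 0 (by linarith)

lemma tendsto_stopLoss (hi : Integrable id P) :
    Tendsto (fun n : ℕ => stopLoss P n) atTop (𝓝 0) := by
  have h := (tendsto_integral_min hi).const_sub (∫ y, y ∂P)
  rw [sub_self] at h
  refine h.congr fun n => ?_
  have e : ∫ y, y - min y (n : ℝ) ∂P = ∫ y, y ∂P - ∫ y, min y (n : ℝ) ∂P :=
    integral_sub hi (integrable_min_const hi _)
  rw [← e, stopLoss]
  refine integral_congr_ae (ae_of_all _ fun y => ?_)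
  rcases le_total y n with h | h
  · simp [h]
  · simp [h]

lemma exists_stopLoss_eq (hi : Integrable id P) {c : ℝ} (hc : 0 < c) (hc' : c ≤ ∫ y, y ∂P) :
    ∃ a, 0 ≤ a ∧ stopLoss P a = c := by
  obtain ⟨n, hn⟩ := ((tendsto_stopLoss hi).eventually_le_const hc).exists
  have h0 : c ≤ stopLoss P 0 := hc'.trans
    (integral_mono hi (integrable_posPart_sub hi 0) fun y => by simp)
  obtain ⟨a, ha, h⟩ := intermediate_value_Icc' (a := (0 : ℝ)) (b := n) n.cast_nonneg
    ((continuousOn_stopLoss hi).mono fun y hy => hy.1) ⟨hn, h0⟩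
  exact ⟨a, ha.1, h⟩

/-- A concave function whose derivative at `a` is `stopLoss P (max a a₀)`. -/
noncomputable def stopLossPrimitive (P : Measure ℝ) (a₀ a : ℝ) : ℝ :=
  ∫ y, ((max (y - a₀) 0) ^ 2 / 2 - (max (y - max a a₀) 0) ^ 2 / 2) ∂P -
    stopLoss P a₀ * (max a a₀ - a)

/-- Tangent inequality for the convex function `x ↦ (x⁺)² / 2`, whose derivative is `x⁺`, at the
point `y - a`. -/
lemma posPart_sq_sub_le (y a b : ℝ) :
    (a - b) * max (y - a) 0 ≤ (max (y - b) 0) ^ 2 / 2 - (max (y - a) 0) ^ 2 / 2 := by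
  rcases le_total (y - a) 0 with h | h <;> rcases le_total (y - b) 0 with h' | h' <;>
    simp only [max_eq_left, max_eq_right, h, h'] <;> nlinarith [sq_nonneg (a - b), sq_nonneg (y - b)]

/-- Concavity of the primitive, in tangent form: integrate `posPart_sq_sub_le` at the levels clipped
to `[a₀, ∞)`. Below `a₀` the function is linear with the slope `stopLoss P a₀`, the largest one. -/
lemma stopLossPrimitive_sub_le (h2 : MemLp id 2 P) (a₀ a b : ℝ) :
    (a - b) * stopLoss P (max a a₀) ≤
      stopLossPrimitive P a₀ a - stopLossPrimitive P a₀ b := by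
  have hi := integrable_id_of_memLp h2
  have hq := fun c => (integrable_posPart_sub_sq h2 c).div_const 2
  set a' := max a a₀ with ha'
  set b' := max b a₀ with hb'
  have h1 : (a' - b') * stopLoss P a' ≤
      ∫ y, (max (y - b') 0) ^ 2 / 2 ∂P - ∫ y, (max (y - a') 0) ^ 2 / 2 ∂P := by
    rw [stopLoss, ← integral_const_mul, ← integral_sub (hq b') (hq a')]
    exact integral_mono ((integrable_posPart_sub hi a').const_mul _) ((hq b').sub (hq a'))
      fun y => posPart_sq_sub_le y a' b'
  rw [stopLossPrimitive, stopLossPrimitive, ← ha', ← hb', integral_sub (hq a₀) (hq a'),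
    integral_sub (hq a₀) (hq b')]
  have hb0 : 0 ≤ b' - b := sub_nonneg.2 (le_max_left _ _)
  rcases le_total a a₀ with h | h
  · have : a' = a₀ := max_eq_right h
    rw [this] at h1 ⊢
    linarith
  · have e : a' = a := max_eq_left h
    rw [e] at h1 ⊢
    have := mul_le_mul_of_nonneg_left (antitone_stopLoss hi h) hb0
    linarith

lemma stopLossPrimitive_le (h2 : MemLp id 2 P) {a₀ : ℝ} (ha₀ : 0 ≤ a₀) (a : ℝ) :
    stopLossPrimitive P a₀ a ≤ ∫ y, y ^ 2 ∂P := by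
  have h1 : 0 ≤ stopLoss P a₀ * (max a a₀ - a) :=
    mul_nonneg (stopLoss_nonneg _) (sub_nonneg.2 (le_max_left _ _))
  have h3 : ∫ y, ((max (y - a₀) 0) ^ 2 / 2 - (max (y - max a a₀) 0) ^ 2 / 2) ∂P ≤
      ∫ y, y ^ 2 ∂P := by
    refine integral_mono (((integrable_posPart_sub_sq h2 _).div_const 2).sub
      ((integrable_posPart_sub_sq h2 _).div_const 2)) h2.integrable_sq fun y => ?_
    have h4 : (max (y - a₀) 0) ^ 2 ≤ y ^ 2 := by
      rcases le_total (y - a₀) 0 with h | h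
      · rw [max_eq_right h]; nlinarith [sq_nonneg y]
      · rw [max_eq_left h]; nlinarith
    nlinarith [sq_nonneg (max (y - max a a₀) 0), sq_nonneg (max (y - a₀) 0)]
  rw [stopLossPrimitive]
  linarith

/-- **Lorden's inequality**, up to the constant: the mean overshoot is bounded uniformly in the
level. -/
theorem exists_lintegral_overshoot_le (h2 : MemLp id 2 P) (hpos : 0 < ∫ y, y ∂P) :
    ∃ A : ℝ, 0 ≤ A ∧ ∀ a, 0 < a →
      ∫⁻ x, ENNReal.ofReal (overshoot a x) ∂(pathLaw P) ≤ ENNReal.ofReal A := by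
  have hi := integrable_id_of_memLp h2
  set μ := ∫ y, y ∂P with hμ
  -- The supersolution is `u = C + (2/μ) Φ` with `Φ' = stopLoss P (max a a₀)`. One step lowers
  -- `(2/μ) Φ` by at least `2ψ` on average, with `ψ = Φ'(a)`. The jumps across the level cost at
  -- most `(1 + 2ψ/μ) stopLoss P a ≤ 2 stopLoss P a`, because the choice of `a₀` gives `ψ ≤ μ/2`.
  -- The two balance when `a ≥ a₀`. When `a < a₀` a crossing, of probability at least `p`, also
  -- releases `C - a₀`, and `C` is chosen so that `(C - a₀) p = 2 stopLoss P 0` covers the cost.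
  obtain ⟨a₀, ha₀, hs⟩ := exists_stopLoss_eq hi (half_pos hpos) (by linarith)
  have hanti := antitone_stopLoss hi
  set p : ℝ := P.real (Set.Ici a₀) with hp
  have hp0 : 0 < p := by
    refine lt_of_le_of_ne measureReal_nonneg fun h => ?_
    have h0 : P (Set.Ici a₀) = 0 := (measureReal_eq_zero_iff).1 h.symm
    have : stopLoss P a₀ = 0 := by
      refine integral_eq_zero_of_ae ?_
      filter_upwards [measure_eq_zero_iff_ae_notMem.1 h0] with y hy
      rw [Set.mem_Ici, not_le] at hy
      exact max_eq_right (by linarith)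
    linarith
  set Φ := stopLossPrimitive P a₀ with hΦ
  set C : ℝ := a₀ + 2 * stopLoss P 0 / p with hC
  have hsl0 : 0 ≤ stopLoss P 0 := stopLoss_nonneg 0
  have hCa : 0 ≤ C - a₀ := by rw [hC]; simp only [add_sub_cancel_left]; positivity
  have hΦ0 : Φ 0 = -(μ / 2 * a₀) := by
    simp [hΦ, stopLossPrimitive, max_eq_right ha₀, hs]
  have hV0 : 0 ≤ ∫ y, y ^ 2 ∂P := integral_nonneg fun y => sq_nonneg y
  refine ⟨C + 2 / μ * ∫ y, y ^ 2 ∂P, by have := hCa; positivity, fun a ha => ?_⟩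
  have key := lintegral_overshoot_le hi hpos (φ := fun c => ENNReal.ofReal c)
    (u := fun a => ENNReal.ofReal (C + 2 / μ * Φ a)) (by fun_prop) ?_ ha
  · refine key.trans (ENNReal.ofReal_le_ofReal ?_)
    gcongr
    exact stopLossPrimitive_le h2 ha₀ a
  intro a ha
  set ψ := stopLoss P (max a a₀) with hψ
  have hψ0 : 0 ≤ ψ := stopLoss_nonneg _
  have hψ1 : ψ ≤ μ / 2 := hs ▸ hanti (le_max_right a a₀)
  have htan : ∀ b, (a - b) * ψ ≤ Φ a - Φ b := fun b => stopLossPrimitive_sub_le h2 a₀ a b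
  have hΦpos : ∀ b, 0 ≤ b → 0 ≤ a₀ + 2 / μ * Φ b := fun b hb => by
    have h1 := stopLossPrimitive_sub_le h2 a₀ b 0
    have h3 : 0 ≤ (b - 0) * stopLoss P (max b a₀) :=
      mul_nonneg (by linarith) (stopLoss_nonneg _)
    have h4 : -(μ / 2 * a₀) ≤ Φ b := by rw [← hΦ0]; linarith
    calc (0 : ℝ) = a₀ + 2 / μ * (-(μ / 2 * a₀)) := by field_simp; ring
      _ ≤ _ := by gcongr
  -- An integrable majorant of both branches of the recursion: the tangent of `u` at `a`, corrected
  -- on the event of a crossing `y ≥ a`.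
  set h : ℝ → ℝ := fun y => C + 2 / μ * (Φ a - y * ψ) + (1 + 2 / μ * ψ) * max (y - a) 0 -
    (C - a₀) * (Set.Ici a).indicator (fun _ => 1) y with hh
  have hlow : ∀ y, a ≤ y → y - a ≤ h y := fun y hy => by
    have h1 := htan 0
    rw [hΦ0] at h1
    have h3 : 0 ≤ 2 / μ * (Φ a + μ / 2 * a₀ - a * ψ) := mul_nonneg (by positivity) (by linarith)
    have h4 : 2 / μ * (μ / 2 * a₀) = a₀ := by field_simp
    simp only [hh, Set.indicator_of_mem (Set.mem_Ici.2 hy), max_eq_left (sub_nonneg.2 hy)]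
    linarith
  have hlow' : ∀ y, y < a → C + 2 / μ * Φ (a - y) ≤ h y := fun y hy => by
    have h1 := htan (a - y)
    have h3 : 2 / μ * Φ (a - y) ≤ 2 / μ * (Φ a - y * ψ) :=
      mul_le_mul_of_nonneg_left (by linarith) (by positivity)
    simp only [hh, Set.indicator_of_notMem (Set.notMem_Ici.2 hy),
      max_eq_right (sub_nonpos.2 hy.le)]
    linarith
  have i0 : Integrable (fun y : ℝ => y * ψ) P := hi.mul_const ψ
  have i0' : Integrable (fun y : ℝ => 2 / μ * (Φ a - y * ψ)) P :=
    ((integrable_const _).sub i0).const_mul _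
  have i1 : Integrable (fun y : ℝ => C + 2 / μ * (Φ a - y * ψ)) P :=
    (integrable_const C).add i0'
  have i2 := (integrable_posPart_sub hi a).const_mul (1 + 2 / μ * ψ)
  have i3 : Integrable (fun y => (C - a₀) * (Set.Ici a).indicator (fun _ => (1 : ℝ)) y) P :=
    ((integrable_const (1 : ℝ)).indicator measurableSet_Ici).const_mul _
  refine lintegral_le_ofReal (h := h) ((i1.add i2).sub i3) (fun y => ?_) (fun y => ?_) ?_
  · rcases le_or_gt a y with hy | hy
    · exact (sub_nonneg.2 hy).trans (hlow y hy)
    · have := hΦpos (a - y) (by linarith)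
      linarith [hlow' y hy]
  · split_ifs with hy
    · exact ENNReal.ofReal_le_ofReal (hlow y hy)
    · exact ENNReal.ofReal_le_ofReal (hlow' y (not_le.1 hy))
  · have e1 : ∫ y, C + 2 / μ * (Φ a - y * ψ) ∂P = C + 2 / μ * (Φ a - μ * ψ) := by
      rw [integral_add (integrable_const C) i0', integral_const_mul,
        integral_sub (integrable_const _) i0, integral_mul_const]
      simp [hμ]
    have e3 : ∫ y, (Set.Ici a).indicator (fun _ => (1 : ℝ)) y ∂P = P.real (Set.Ici a) := by
      rw [integral_indicator measurableSet_Ici]; simp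
    have i12 : Integrable (fun y => C + 2 / μ * (Φ a - y * ψ) +
        (1 + 2 / μ * ψ) * max (y - a) 0) P := i1.add i2
    simp only [hh]
    rw [integral_sub i12 i3, integral_add i1 i2, integral_const_mul, integral_const_mul, e1, e3]
    change _ + (1 + 2 / μ * ψ) * stopLoss P a - _ ≤ _
    have e4 : 2 / μ * (Φ a - μ * ψ) = 2 / μ * Φ a - 2 * ψ := by field_simp
    rw [e4]
    have h5 : 2 / μ * ψ ≤ 1 := by
      rw [div_mul_eq_mul_div, div_le_one hpos]; linarith
    have hsla : 0 ≤ stopLoss P a := stopLoss_nonneg a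
    have h6 : (1 + 2 / μ * ψ) * stopLoss P a ≤ 2 * stopLoss P a :=
      mul_le_mul_of_nonneg_right (by linarith) hsla
    rcases le_total a₀ a with h7 | h7
    · have : ψ = stopLoss P a := by rw [hψ, max_eq_left h7]
      have h8 : 0 ≤ (C - a₀) * P.real (Set.Ici a) := mul_nonneg hCa measureReal_nonneg
      linarith
    · have h8 : p ≤ P.real (Set.Ici a) := measureReal_mono (Set.Ici_subset_Ici.2 h7)
      have h9 : (C - a₀) * p ≤ (C - a₀) * P.real (Set.Ici a) :=
        mul_le_mul_of_nonneg_left h8 hCa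
      have h10 : (C - a₀) * p = 2 * stopLoss P 0 := by
        rw [hC]; field_simp; ring
      have := hanti ha.le
      linarith

end

end SensorFusion

/-! ### Kolmogorov's inequality and convergence in probability. -/

namespace SensorFusion

section

variable {E : Type*} [MeasurableSpace E] {Q : Measure E}

/-- **Kolmogorov's maximal inequality** for the sums of a centered square integrable function `ξ`
along the orbits of a transformation `θ` that renews the process. -/
theorem measure_exists_le_abs_sum_iterate [IsProbabilityMeasure Q] {ξ : E → ℝ} {θ : E → E}
    (hξ : Measurable ξ) (hθ : Measurable θ)
    (hmap : Q.map (fun x => (ξ x, θ x)) = (Q.map ξ).prod Q) (h2 : MemLp ξ 2 Q)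
    (h0 : ∫ x, ξ x ∂Q = 0) {V : ℝ} (hV : ∫ x, ξ x ^ 2 ∂Q ≤ V) {ε : ℝ} (hε : 0 < ε) (n : ℕ)
    (c : ℝ) :
    Q {x | ∃ k ≤ n, ε ≤ |c + ∑ i ∈ Finset.range k, ξ (θ^[i] x)|} ≤
      ENNReal.ofReal ((c ^ 2 + n * V) / ε ^ 2) := by
  have hi : Integrable ξ Q := h2.integrable (by norm_num)
  have hV0 : 0 ≤ V := (integral_nonneg fun x => sq_nonneg _).trans hV
  -- The starting value `c` is kept free so that the first term can be absorbed into it. If `ε ≤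
  -- |c|` the bound is at least `1`; otherwise `E (c + ξ)² ≤ c² + V` because `ξ` is centered.
  induction n generalizing c with
  | zero =>
    by_cases hc : ε ≤ |c|
    · refine prob_le_one.trans (ENNReal.one_le_ofReal.2 ((one_le_div (by positivity)).2 ?_))
      have := sq_le_sq' (by linarith [abs_nonneg c]) hc
      rw [sq_abs] at this
      simpa using this
    · simp [hc]
  | succ n ih =>
    by_cases hc : ε ≤ |c|
    · refine prob_le_one.trans (ENNReal.one_le_ofReal.2 ((one_le_div (by positivity)).2 ?_))
      have := sq_le_sq' (by linarith [abs_nonneg c]) hc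
      rw [sq_abs] at this
      have : 0 ≤ ((n + 1 : ℕ) : ℝ) * V := by positivity
      linarith
    set A : Set (ℝ × E) := {p | ∃ k ≤ n, ε ≤ |(c + p.1) + ∑ i ∈ Finset.range k, ξ (θ^[i] p.2)|}
      with hA
    have hAm : MeasurableSet A := by
      have : A = ⋃ k ∈ Set.Iic n,
          {p : ℝ × E | ε ≤ |(c + p.1) + ∑ i ∈ Finset.range k, ξ (θ^[i] p.2)|} := by
        ext p; simp [hA]
      rw [this]
      refine MeasurableSet.biUnion (Set.to_countable _) fun k _ =>
        measurableSet_le measurable_const ?_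
      have hs : Measurable fun p : ℝ × E => ∑ i ∈ Finset.range k, ξ (θ^[i] p.2) :=
        Finset.measurable_sum _ fun i _ => (hξ.comp (hθ.iterate i)).comp measurable_snd
      exact ((measurable_fst.const_add c).add hs).abs
    have hsub : {x | ∃ k ≤ n + 1, ε ≤ |c + ∑ i ∈ Finset.range k, ξ (θ^[i] x)|} ⊆
        (fun x => (ξ x, θ x)) ⁻¹' A := by
      rintro x ⟨_ | k, hk, h⟩
      · simp at h; exact absurd h hc
      · refine ⟨k, by omega, ?_⟩
        rw [Finset.sum_range_succ'] at h
        simp only [Function.iterate_succ_apply, Function.iterate_zero, id] at h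
        rwa [add_assoc, add_comm (ξ x)]
    have hi2 : Integrable (fun x => ξ x ^ 2) Q := h2.integrable_sq
    refine (measure_mono hsub).trans ?_
    rw [← Measure.map_apply (hξ.prodMk hθ) hAm, hmap, Measure.prod_apply hAm,
      lintegral_map (measurable_measure_prodMk_left hAm) hξ]
    have e : (fun x => ((c + ξ x) ^ 2 + n * V) / ε ^ 2) =
        fun x => ((c ^ 2 + n * V) + 2 * c * ξ x + ξ x ^ 2) / ε ^ 2 := by
      ext x; ring
    have i1 : Integrable (fun x => (c ^ 2 + n * V) + 2 * c * ξ x) Q :=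
      (integrable_const _).add (hi.const_mul _)
    refine lintegral_le_ofReal (h := fun x => ((c + ξ x) ^ 2 + n * V) / ε ^ 2) ?_
      (fun x => by positivity) (fun x => ih (c + ξ x)) ?_
    · rw [e]; exact (i1.add hi2).div_const _
    · rw [e, integral_div, integral_add i1 hi2, integral_add (integrable_const _) (hi.const_mul _),
        integral_const_mul, h0]
      simp only [integral_const, probReal_univ, one_smul, mul_zero, add_zero]
      refine div_le_div_of_nonneg_right ?_ (by positivity)
      push_cast
      linarith

/-! ### Events whose probability tends to one -/

/-- The filter on `ℕ × E` of the sequences of events whose probability tends to `1`; convergence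
along it is convergence in probability. -/
def whp (Q : Measure E) : Filter (ℕ × E) where
  sets := {s | Tendsto (fun n => Q {x | (n, x) ∉ s}) atTop (𝓝 0)}
  univ_sets := by simp
  sets_of_superset {s t} hs hst := tendsto_of_tendsto_of_tendsto_of_le_of_le tendsto_const_nhds hs
    (fun _ => zero_le) fun _ => measure_mono fun _ hx h => hx (hst h)
  inter_sets {s t} hs ht := by
    have h := Tendsto.add (M := ℝ≥0∞) hs ht
    rw [add_zero] at h
    refine tendsto_of_tendsto_of_tendsto_of_le_of_le tendsto_const_nhds h
      (fun _ => zero_le) fun n => (measure_mono fun x hx => ?_).trans (measure_union_le _ _)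
    by_contra hne
    simp only [Set.mem_union, Set.mem_ofPred_eq, not_or, not_not] at hne
    exact hx hne

lemma eventually_whp {p : ℕ × E → Prop} :
    (∀ᶠ z in whp Q, p z) ↔ Tendsto (fun n => Q {x | ¬p (n, x)}) atTop (𝓝 0) := Iff.rfl

lemma eventually_whp_of_ae {p : ℕ × E → Prop} (h : ∀ᶠ n in atTop, ∀ᵐ x ∂Q, p (n, x)) :
    ∀ᶠ z in whp Q, p z :=
  eventually_whp.2 <| tendsto_const_nhds.congr' <| h.mono fun _ hn => (ae_iff.1 hn).symm

lemma tendsto_fst_whp : Tendsto Prod.fst (whp Q) atTop := fun s hs =>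
  eventually_whp_of_ae (p := fun z => z.1 ∈ s)
    (Filter.mem_of_superset hs fun _ hn => ae_of_all _ fun _ => hn)

lemma eventually_whp_of_le {p : ℕ × E → Prop} {b : ℕ → ℝ} (hb : Tendsto b atTop (𝓝 0))
    (h : ∀ᶠ n in atTop, Q {x | ¬p (n, x)} ≤ ENNReal.ofReal (b n)) : ∀ᶠ z in whp Q, p z := by
  have hb' := ENNReal.tendsto_ofReal hb
  rw [ENNReal.ofReal_zero] at hb'
  exact eventually_whp.2 <| tendsto_of_tendsto_of_tendsto_of_le_of_le' tendsto_const_nhds hb'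
    (Eventually.of_forall fun _ => zero_le) h

lemma eventually_whp_of_ae_eventually [IsFiniteMeasure Q] {p : ℕ × E → Prop}
    (hm : ∀ n, MeasurableSet {x | p (n, x)}) (h : ∀ᵐ x ∂Q, ∀ᶠ n in atTop, p (n, x)) :
    ∀ᶠ z in whp Q, p z := by
  have := tendsto_measure_of_ae_tendsto_indicator_of_isFiniteMeasure (μ := Q) atTop
    (A := ∅) (As := fun n => {x | ¬p (n, x)}) .empty (fun n => (hm n).compl)
    (h.mono fun x hx => hx.mono fun n hn => by simp [hn])
  rwa [measure_empty] at this

lemma tendsto_whp_zero_iff {f : ℕ × E → ℝ} :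
    Tendsto f (whp Q) (𝓝 0) ↔ ∀ ε > 0, ∀ᶠ z in whp Q, |f z| < ε := by
  simp [Metric.tendsto_nhds]

lemma tendstoInMeasure_of_tendsto_whp {f : ℕ → E → ℝ}
    (h : Tendsto (fun z : ℕ × E => f z.1 z.2) (whp Q) (𝓝 0)) :
    TendstoInMeasure Q f atTop 0 := by
  rw [tendstoInMeasure_iff_norm]
  intro ε hε
  have := eventually_whp.1 (tendsto_whp_zero_iff.1 h ε hε)
  simpa using this

/-- Transports the limits proved on path space to the space on which all sensors are defined. -/
lemma tendsto_map_whp {E' : Type*} [MeasurableSpace E'] {f : E → E'} (hf : Measurable f) :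
    Tendsto (Prod.map id f) (whp Q) (whp (Q.map f)) := fun _ hs =>
  tendsto_of_tendsto_of_tendsto_of_le_of_le tendsto_const_nhds hs (fun _ => zero_le)
    fun _ => Measure.le_map_apply hf.aemeasurable _

end

/-! ### Maximal inequalities for the walk and the overshoots -/

section

variable {P : Measure ℝ} [IsProbabilityMeasure P]

lemma integral_eval_pathLaw {f : ℝ → ℝ} (hf : Measurable f) (i : ℕ) :
    ∫ x, f (x i) ∂(pathLaw P) = ∫ y, f y ∂P := by
  conv_rhs => rw [← map_eval_pathLaw (P := P) i]
  rw [integral_map (measurable_pi_apply i).aemeasurable hf.aestronglyMeasurable]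

lemma shift_one_iterate (n : ℕ) (x : ℕ → ℝ) : (shift 1)^[n] x = shift n x := by
  induction n with
  | zero => simp
  | succ n ih => rw [Function.iterate_succ_apply', ih, shift_shift]

theorem measure_exists_le_abs_walk_sub (h2 : MemLp id 2 P) {ε : ℝ} (hε : 0 < ε) (n : ℕ) :
    pathLaw P {x | ∃ k ≤ n, ε ≤ |walk x k - k * ∫ y, y ∂P|} ≤
      ENNReal.ofReal (n * (∫ y, (y - ∫ z, z ∂P) ^ 2 ∂P) / ε ^ 2) := by
  set μ := ∫ y, y ∂P
  have hi := integrable_id_of_memLp h2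
  have hmf : Measurable fun x : ℕ → ℝ => x 0 - μ := by fun_prop
  have hmap : (pathLaw P).map (fun x => (x 0 - μ, shift 1 x)) =
      ((pathLaw P).map fun x => x 0 - μ).prod (pathLaw P) := by
    have e : (fun x : ℕ → ℝ => (x 0 - μ, shift 1 x)) =
        (Prod.map (fun y : ℝ => y - μ) id) ∘ fun x => (x 0, shift 1 x) := rfl
    have e' : (fun x : ℕ → ℝ => x 0 - μ) = (fun y : ℝ => y - μ) ∘ fun x => x 0 := rfl
    rw [e, ← Measure.map_map (by fun_prop) (by fun_prop), map_first_shift, e',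
      ← Measure.map_map (by fun_prop) (by fun_prop), map_eval_pathLaw,
      ← Measure.map_prod_map _ _ (by fun_prop) measurable_id, Measure.map_id]
  have hL : MemLp (fun x : ℕ → ℝ => x 0 - μ) 2 (pathLaw P) := by
    have : MemLp (fun y => y - μ) 2 P := h2.sub (memLp_const μ)
    rw [← map_eval_pathLaw (P := P) 0] at this
    exact this.comp_of_map (measurable_pi_apply 0).aemeasurable
  have key := measure_exists_le_abs_sum_iterate hmf (measurable_shift 1) hmap hL
    (V := ∫ y, (y - μ) ^ 2 ∂P) ?_ ?_ hε n 0
  · have e : ∀ (x : ℕ → ℝ) (k : ℕ),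
        0 + ∑ i ∈ Finset.range k, (((shift 1)^[i] x) 0 - μ) = walk x k - k * μ := by
      intro x k
      simp [shift_one_iterate, walk, Finset.sum_sub_distrib]
    simp only [e] at key
    simpa using key
  · rw [integral_eval_pathLaw (f := fun y => y - μ) (by fun_prop)]
    have : ∫ y, (y - μ) ∂P = ∫ y, y ∂P - ∫ y, μ ∂P := integral_sub hi (integrable_const μ)
    rw [this]; simp [μ]
  · exact (integral_eval_pathLaw (f := fun y => (y - μ) ^ 2) (by fun_prop) 0).le

lemma integrable_overshoot_of_lintegral_le (hi : Integrable id P) (hpos : 0 < ∫ y, y ∂P) {a A : ℝ}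
    (h : ∫⁻ x, ENNReal.ofReal (overshoot a x) ∂(pathLaw P) ≤ ENNReal.ofReal A) :
    Integrable (overshoot a) (pathLaw P) :=
  (lintegral_ofReal_ne_top_iff_integrable (measurable_overshoot a).aestronglyMeasurable
    ((ae_mem_driftPaths hi hpos).mono fun _ hx => overshoot_nonneg a hx)).1
    (h.trans_lt ENNReal.ofReal_lt_top).ne

lemma meanOvershoot_nonneg (hi : Integrable id P) (hpos : 0 < ∫ y, y ∂P) (a : ℝ) :
    0 ≤ meanOvershoot P a :=
  integral_nonneg_of_ae ((ae_mem_driftPaths hi hpos).mono fun _ hx => overshoot_nonneg a hx)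

theorem exists_meanOvershoot_le (h2 : MemLp id 2 P) (hpos : 0 < ∫ y, y ∂P) :
    ∃ A : ℝ, 0 ≤ A ∧ ∀ a, 0 < a → meanOvershoot P a ≤ A := by
  have hi := integrable_id_of_memLp h2
  obtain ⟨A, hA, h⟩ := exists_lintegral_overshoot_le h2 hpos
  refine ⟨A, hA, fun a ha => ?_⟩
  have h0 := (ae_mem_driftPaths hi hpos).mono fun _ hx => overshoot_nonneg a hx
  have := h a ha
  rw [← ofReal_integral_eq_lintegral_ofReal
    (integrable_overshoot_of_lintegral_le hi hpos this) h0] at this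
  exact (ENNReal.ofReal_le_ofReal_iff hA).1 this

theorem exists_measure_exists_le_abs_walk_epoch_sub (h2 : MemLp id 2 P) (hpos : 0 < ∫ y, y ∂P)
    {δ : ℝ} (hδ : 0 < δ) : ∃ A : ℝ, 0 ≤ A ∧ ∀ a, 0 < a → ∀ ε, 0 < ε → ∀ n : ℕ,
      pathLaw P {x | ∃ k ≤ n, ε ≤ |walk x (epoch a x k) - k * (a + meanOvershoot P a)|} ≤
        ENNReal.ofReal (n * (A + δ * a) / ε ^ 2) := by
  have hi := integrable_id_of_memLp h2
  obtain ⟨A, hA, h⟩ := exists_lintegral_sq_overshoot_le h2 hpos hδ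
  refine ⟨A, hA, fun a ha ε hε n => ?_⟩
  have hm := measurable_overshoot a
  have hsq : Integrable (fun x => overshoot a x ^ 2) (pathLaw P) :=
    (lintegral_ofReal_ne_top_iff_integrable (hm.pow_const 2).aestronglyMeasurable
      (ae_of_all _ fun x => sq_nonneg _)).1 ((h a ha).trans_lt ENNReal.ofReal_lt_top).ne
  have hL : MemLp (overshoot a) 2 (pathLaw P) :=
    (memLp_two_iff_integrable_sq hm.aestronglyMeasurable).2 hsq
  have hint : Integrable (overshoot a) (pathLaw P) := hL.integrable (by norm_num)
  have hle : ∫ x, overshoot a x ^ 2 ∂(pathLaw P) ≤ A + δ * a := by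
    have := h a ha
    rw [← ofReal_integral_eq_lintegral_ofReal hsq (ae_of_all _ fun x => sq_nonneg _)] at this
    exact (ENNReal.ofReal_le_ofReal_iff (by positivity)).1 this
  set m := meanOvershoot P a with hmdef
  have hmean : ∫ x, overshoot a x ∂(pathLaw P) = m := rfl
  have hmap : (pathLaw P).map (fun x => (overshoot a x - m, restart a x)) =
      ((pathLaw P).map fun x => overshoot a x - m).prod (pathLaw P) := by
    have e : (fun x : ℕ → ℝ => (overshoot a x - m, restart a x)) =
        (Prod.map (fun y : ℝ => y - m) id) ∘ fun x => (overshoot a x, restart a x) := rfl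
    have e' : (fun x : ℕ → ℝ => overshoot a x - m) = (fun y : ℝ => y - m) ∘ overshoot a := rfl
    have : IsProbabilityMeasure ((pathLaw P).map (overshoot a)) :=
      Measure.isProbabilityMeasure_map hm.aemeasurable
    rw [e, ← Measure.map_map (by fun_prop) (hm.prodMk (measurable_restart a)),
      map_overshoot_restart hi hpos, e', ← Measure.map_map (by fun_prop) hm,
      ← Measure.map_prod_map _ _ (by fun_prop) measurable_id, Measure.map_id]
  have key := measure_exists_le_abs_sum_iterate (hm.sub_const m) (measurable_restart a) hmap
    (hL.sub (memLp_const m)) (V := A + δ * a) ?_ ?_ hε n 0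
  · have e : ∀ (x : ℕ → ℝ) (k : ℕ),
        0 + ∑ i ∈ Finset.range k, (overshoot a ((restart a)^[i] x) - m) =
          walk x (epoch a x k) - k * (a + m) := by
      intro x k
      rw [walk_epoch]
      simp [Finset.sum_sub_distrib, Finset.sum_add_distrib]
      ring
    simp only [e] at key
    simpa using key
  · rw [integral_sub hint (integrable_const m), hmean]; simp
  · refine le_trans ?_ hle
    have e : ∀ x, (overshoot a x - m) ^ 2 = overshoot a x ^ 2 - 2 * m * overshoot a x + m ^ 2 :=
      fun x => by ring
    have i1 : Integrable (fun x => overshoot a x ^ 2 - 2 * m * overshoot a x) (pathLaw P) :=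
      hsq.sub (hint.const_mul _)
    simp_rw [e]
    rw [integral_add i1 (integrable_const _), integral_sub hsq (hint.const_mul _),
      integral_const_mul, hmean]
    simp only [integral_const, probReal_univ, one_smul]
    nlinarith [sq_nonneg m]

end

end SensorFusion

/-! ### Asymptotics of a single sensor. -/

namespace SensorFusion

/-- The regime of times and thresholds: `1 ≪ Δ ≪ t`. -/
structure Regime (t : ℕ → ℕ) (Δ : ℕ → ℝ) : Prop where
  pos : ∀ n, 0 < Δ n
  tendsto_threshold : Tendsto Δ atTop atTop
  tendsto_time : Tendsto t atTop atTop
  ratio : Tendsto (fun n => Δ n / t n) atTop (𝓝 0)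

/-- The walk, centered at its mean under the law `P` of the increments. -/
noncomputable def centeredWalk (P : Measure ℝ) (x : ℕ → ℝ) (n : ℕ) : ℝ :=
  walk x n - n * ∫ y, y ∂P

lemma centeredWalk_add (P : Measure ℝ) (x : ℕ → ℝ) (n m : ℕ) :
    centeredWalk P x (n + m) = centeredWalk P x n + centeredWalk P (shift n x) m := by
  simp only [centeredWalk, walk_add]; push_cast; ring

/-- The permutation of the coordinates that reverses the first `n` of them. -/
def reverse (n : ℕ) (x : ℕ → ℝ) : ℕ → ℝ := fun i => x (if i < n then n - 1 - i else i)

lemma walk_reverse {n j : ℕ} (hj : j ≤ n) (x : ℕ → ℝ) :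
    walk (reverse n x) (n - j) = walk x n - walk x j := by
  obtain ⟨k, rfl⟩ := Nat.exists_eq_add_of_le hj
  rw [walk_add, add_sub_cancel_left, Nat.add_sub_cancel_left, walk, walk,
    ← Finset.sum_range_reflect]
  refine Finset.sum_congr rfl fun i hi => ?_
  have := Finset.mem_range.1 hi
  rw [reverse, if_pos (by omega), shift_apply]
  congr 1
  omega

lemma Regime.tendsto_sqrt {t : ℕ → ℕ} {Δ : ℕ → ℝ} (h : Regime t Δ) :
    Tendsto (fun n => √(t n : ℝ)) atTop atTop :=
  Real.tendsto_sqrt_atTop.comp (tendsto_natCast_atTop_atTop.comp h.tendsto_time)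

lemma Regime.eventually_time_pos {t : ℕ → ℕ} {Δ : ℕ → ℝ} (h : Regime t Δ) :
    ∀ᶠ n in atTop, 0 < t n := h.tendsto_time.eventually_gt_atTop 0

section

variable {P : Measure ℝ} [IsProbabilityMeasure P] {t : ℕ → ℕ} {Δ : ℕ → ℝ}

lemma map_reverse_pathLaw (n : ℕ) : (pathLaw P).map (reverse n) = pathLaw P := by
  refine Measure.map_infinitePi_infinitePi_of_inj (P := fun _ : ℕ => P)
    (f := fun i => if i < n then n - 1 - i else i) fun i j hij => ?_
  dsimp only at hij
  split_ifs at hij <;> omega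

lemma eventually_mem_driftPaths (h2 : MemLp id 2 P) (hpos : 0 < ∫ y, y ∂P) :
    ∀ᶠ z in whp (pathLaw P), z.2 ∈ driftPaths :=
  eventually_whp_of_ae (p := fun z => z.2 ∈ driftPaths)
    (Eventually.of_forall fun _ => ae_mem_driftPaths (integrable_id_of_memLp h2) hpos)

/-- A path tending to `+∞` has a finite global minimum, which `-Δ` eventually undercuts. -/
lemma eventually_neg_le_walk (h2 : MemLp id 2 P) (hpos : 0 < ∫ y, y ∂P)
    (hΔ : Tendsto Δ atTop atTop) : ∀ᶠ z in whp (pathLaw P), ∀ j, -Δ z.1 ≤ walk z.2 j := by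
  refine eventually_whp_of_ae_eventually (fun n => ?_) ?_
  · simp_rw [Set.ofPred_forall]
    exact MeasurableSet.iInter fun j => measurableSet_le measurable_const (measurable_walk j)
  · filter_upwards [ae_mem_driftPaths (integrable_id_of_memLp h2) hpos] with x hx
    obtain ⟨c, hc⟩ := bddBelow_range_of_tendsto_atTop_atTop hx
    filter_upwards [hΔ.eventually_ge_atTop (-c)] with n hn j
    exact (by linarith : -Δ n ≤ c).trans (hc ⟨j, rfl⟩)

/-- Reversing the first `s` increments preserves the law and turns the increments of the walk up to
time `s` into values of a walk from `0`, so the previous lemma gives a bound uniform in `j`. -/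
lemma eventually_neg_le_walk_sub (h2 : MemLp id 2 P) (hpos : 0 < ∫ y, y ∂P)
    (hΔ : Tendsto Δ atTop atTop) (s : ℕ → ℕ) :
    ∀ᶠ z in whp (pathLaw P), ∀ j ≤ s z.1, -Δ z.1 ≤ walk z.2 (s z.1) - walk z.2 j := by
  refine eventually_whp.2 <| tendsto_of_tendsto_of_tendsto_of_le_of_le tendsto_const_nhds
    (eventually_whp.1 (eventually_neg_le_walk h2 hpos hΔ)) (fun _ => zero_le) fun n => ?_
  have hm : Measurable (reverse (s n)) := by unfold reverse; fun_prop
  calc _ ≤ pathLaw P (reverse (s n) ⁻¹' {x | ¬∀ j, -Δ n ≤ walk x j}) := by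
        refine measure_mono fun x hx h => hx fun j hj => ?_
        rw [← walk_reverse hj]
        exact h _
    _ ≤ (pathLaw P).map (reverse (s n)) {x | ¬∀ j, -Δ n ≤ walk x j} :=
        Measure.le_map_apply hm.aemeasurable _
    _ = _ := by rw [map_reverse_pathLaw]

lemma eventually_abs_centeredWalk_lt (h2 : MemLp id 2 P) (s L : ℕ → ℕ) {r : ℕ → ℝ}
    (hr : ∀ᶠ n in atTop, 0 < r n) (hL : Tendsto (fun n => L n / r n ^ 2) atTop (𝓝 0)) :
    ∀ᶠ z in whp (pathLaw P), ∀ k ≤ L z.1, |centeredWalk P (shift (s z.1) z.2) k| < r z.1 := by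
  have hb := hL.mul_const (∫ y, (y - ∫ z, z ∂P) ^ 2 ∂P)
  rw [zero_mul] at hb
  refine eventually_whp_of_le hb ?_
  filter_upwards [hr] with n hn
  calc _ ≤ pathLaw P (shift (s n) ⁻¹' {x | ∃ k ≤ L n, r n ≤ |walk x k - k * ∫ y, y ∂P|}) := by
        refine measure_mono fun x hx => ?_
        simpa [centeredWalk] using hx
    _ ≤ (pathLaw P).map (shift (s n)) {x | ∃ k ≤ L n, r n ≤ |walk x k - k * ∫ y, y ∂P|} :=
        Measure.le_map_apply (measurable_shift _).aemeasurable _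
    _ ≤ _ := by
        rw [map_shift_pathLaw]
        refine (measure_exists_le_abs_walk_sub h2 hn (L n)).trans (ENNReal.ofReal_le_ofReal ?_)
        rw [div_mul_eq_mul_div]

/-- After `T` the walk stays below `S_T + Δ` up to time `t - 1`. A silence longer than `b`
contradicts this: the last `L = ⌊b⌋` steps gain more than `L μ / 2 ≥ 2Δ`, while the earlier steps
since `T` lose at most `Δ`. -/
lemma eventually_sub_lastComm_le (h2 : MemLp id 2 P) (hpos : 0 < ∫ y, y ∂P) (h : Regime t Δ)
    {b : ℕ → ℝ} (hb0 : ∀ᶠ n in atTop, 0 < b n)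
    (hb : Tendsto (fun n => Δ n / b n) atTop (𝓝 0)) :
    ∀ᶠ z in whp (pathLaw P),
      (t z.1 : ℝ) - lastComm (Δ z.1) z.2 (t z.1) ≤ b z.1 := by
  set μ := ∫ y, y ∂P with hμ
  set L : ℕ → ℕ := fun n => ⌊b n⌋₊ with hLdef
  have hbt : Tendsto b atTop atTop := by
    refine tendsto_atTop_mono' _ ?_ h.tendsto_threshold
    filter_upwards [hb.eventually_le_const zero_lt_one, hb0] with n hn hn0
    exact (div_le_one hn0).1 hn
  have hLt : Tendsto L atTop atTop := tendsto_nat_floor_atTop.comp hbt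
  have hLtR : Tendsto (fun n => (L n : ℝ)) atTop atTop := tendsto_natCast_atTop_atTop.comp hLt
  have hLΔ : ∀ᶠ n in atTop, 2 * Δ n ≤ L n * μ / 2 := by
    filter_upwards [hb.eventually_le_const (show 0 < μ / 8 by positivity), hb0,
      hbt.eventually_ge_atTop 2] with n hn hn0 hn2
    have h1 := (div_le_iff₀ hn0).1 hn
    have h3 : b n < L n + 1 := Nat.lt_floor_add_one _
    nlinarith
  -- The window ends at `t - 1`, since a communication at time `t` itself is not yet counted in
  -- `N_t`.
  have e1 := eventually_abs_centeredWalk_lt h2 (fun n => t n - 1 - L n) L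
    (r := fun n => L n * μ / 2) ?_ ?_
  · filter_upwards [e1, eventually_mem_driftPaths h2 hpos,
      eventually_neg_le_walk_sub h2 hpos h.tendsto_threshold (fun n => t n - 1 - L n),
      tendsto_fst_whp.eventually hLΔ, tendsto_fst_whp.eventually hb0,
      tendsto_fst_whp.eventually h.eventually_time_pos] with ⟨n, x⟩ h1 hx h3 h4 h5 h6
    dsimp only at *
    obtain ⟨hlt, hge⟩ := msgCount_spec (h.pos n) hx h6
    rw [← lastComm_eq_epoch _ hx] at hlt
    set T := lastComm (Δ n) x (t n) with hT
    have hfl : (L n : ℝ) ≤ b n := Nat.floor_le h5.le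
    by_contra hcon
    have hTL : L n + T < t n := by
      have : (L n : ℝ) + T < t n := by linarith
      exact_mod_cast this
    set s := t n - 1 - L n with hs
    have hsT : T ≤ s := by omega
    have h7 := h3 T hsT
    have h8 := h1 (L n) le_rfl
    have h9 : walk x (s + L n) - walk x T < Δ n := by
      rw [hT, lastComm_eq_epoch _ hx] at hsT ⊢
      exact walk_sub_lt_of_lt_epoch (by omega) (by omega)
    rw [walk_add] at h9
    rw [centeredWalk, abs_lt, ← hμ] at h8
    linarith [h8.1]
  · filter_upwards [hLtR.eventually_gt_atTop 0] with n hn using by positivity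
  · have h1 : Tendsto (fun n => 4 / μ ^ 2 * (L n : ℝ)⁻¹) atTop (𝓝 (4 / μ ^ 2 * 0)) :=
      (tendsto_inv_atTop_zero.comp hLtR).const_mul _
    rw [mul_zero] at h1
    refine h1.congr' ?_
    filter_upwards [hLtR.eventually_gt_atTop 0] with n hn
    field_simp
    ring

lemma tendsto_sub_lastComm_div (h2 : MemLp id 2 P) (hpos : 0 < ∫ y, y ∂P) (h : Regime t Δ)
    {b : ℕ → ℝ} (hb0 : ∀ᶠ n in atTop, 0 < b n)
    (hb : Tendsto (fun n => Δ n / b n) atTop (𝓝 0)) :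
    Tendsto (fun z : ℕ × (ℕ → ℝ) => ((t z.1 : ℝ) - lastComm (Δ z.1) z.2 (t z.1)) / b z.1)
      (whp (pathLaw P)) (𝓝 0) := by
  refine tendsto_whp_zero_iff.2 fun ε hε => ?_
  have hb' : Tendsto (fun n => Δ n / (ε / 2 * b n)) atTop (𝓝 0) := by
    have := hb.const_mul (ε / 2)⁻¹
    rw [mul_zero] at this
    exact this.congr fun n => by rw [div_mul_eq_div_div_swap, inv_mul_eq_div]
  filter_upwards [eventually_sub_lastComm_le h2 hpos h (b := fun n => ε / 2 * b n)
      (hb0.mono fun n hn => by positivity) hb', eventually_mem_driftPaths h2 hpos,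
    tendsto_fst_whp.eventually hb0, tendsto_fst_whp.eventually h.eventually_time_pos]
    with ⟨n, x⟩ h1 hx h3 h4
  dsimp only at *
  have hlt := (msgCount_spec (h.pos n) hx h4).1
  rw [← lastComm_eq_epoch _ hx] at hlt
  have hlt' : (lastComm (Δ n) x (t n) : ℝ) < t n := by exact_mod_cast hlt
  rw [abs_of_nonneg (div_nonneg (by linarith) h3.le), div_lt_iff₀ h3]
  have : 0 < ε * b n := by positivity
  linarith

lemma Regime.tendsto_div_sqrt_mul (h : Regime t Δ) :
    Tendsto (fun n => Δ n / √(Δ n * t n)) atTop (𝓝 0) ∧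
      Tendsto (fun n => √(Δ n * t n) / t n) atTop (𝓝 0) := by
  have h1 : Tendsto (fun n => √(Δ n / t n)) atTop (𝓝 0) := by
    have := (Real.continuous_sqrt.tendsto 0).comp h.ratio
    rwa [Real.sqrt_zero] at this
  constructor <;> refine h1.congr' ?_ <;>
    filter_upwards [h.eventually_time_pos] with n hn <;>
    have ht : (0 : ℝ) < t n := (by exact_mod_cast hn) <;>
    have hD := h.pos n <;>
    rw [Real.sqrt_div hD.le, Real.sqrt_mul hD.le]
  · nth_rewrite 2 [← Real.mul_self_sqrt hD.le]
    rw [mul_div_mul_left _ _ (Real.sqrt_pos.2 hD).ne']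
  · nth_rewrite 3 [← Real.mul_self_sqrt ht.le]
    rw [mul_div_mul_right _ _ (Real.sqrt_pos.2 ht).ne']

/-- As `T` is random, both `T` and `t` are compared with a deterministic time `s = t - L`, where `L
= ⌊√(Δ t)⌋`. Since `Δ ≪ √(Δ t) ≪ t`, the window contains `T` with high probability and the walk
fluctuates by `o(√t)` on it. -/
lemma tendsto_centeredWalk_lastComm_sub (h2 : MemLp id 2 P) (hpos : 0 < ∫ y, y ∂P)
    (h : Regime t Δ) :
    Tendsto (fun z : ℕ × (ℕ → ℝ) => (centeredWalk P z.2 (lastComm (Δ z.1) z.2 (t z.1)) -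
      centeredWalk P z.2 (t z.1)) / √(t z.1)) (whp (pathLaw P)) (𝓝 0) := by
  refine tendsto_whp_zero_iff.2 fun ε hε => ?_
  set b : ℕ → ℝ := fun n => √(Δ n * t n) with hb
  have hb0 : ∀ᶠ n in atTop, 0 < b n := h.eventually_time_pos.mono fun n hn => by
    have := h.pos n
    have : (0 : ℝ) < t n := by exact_mod_cast hn
    positivity
  set L : ℕ → ℕ := fun n => ⌊b n⌋₊ with hL
  have e1 := eventually_abs_centeredWalk_lt h2 (fun n => t n - L n) L
    (r := fun n => ε / 2 * √(t n)) ?_ ?_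
  · filter_upwards [e1, eventually_sub_lastComm_le h2 hpos h hb0 h.tendsto_div_sqrt_mul.1,
      eventually_mem_driftPaths h2 hpos,
      tendsto_fst_whp.eventually h.eventually_time_pos] with ⟨n, x⟩ h1 h3 hx h4
    dsimp only at *
    have hlt := (msgCount_spec (h.pos n) hx h4).1
    rw [← lastComm_eq_epoch _ hx] at hlt
    set T := lastComm (Δ n) x (t n)
    have hTL : t n - T ≤ L n := Nat.le_floor (by rwa [Nat.cast_sub hlt.le])
    set s := t n - L n
    obtain ⟨k, hk⟩ := Nat.exists_eq_add_of_le (show s ≤ T by omega)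
    obtain ⟨l, hl⟩ := Nat.exists_eq_add_of_le (show s ≤ t n by omega)
    have h5 := h1 k (by omega)
    have h6 := h1 l (by omega)
    have hs : 0 < √(t n : ℝ) := Real.sqrt_pos.2 (by exact_mod_cast h4)
    rw [abs_div, abs_of_pos hs, div_lt_iff₀ hs]
    have h7 : centeredWalk P x T = centeredWalk P x s + centeredWalk P (shift s x) k := by
      rw [hk, centeredWalk_add]
    have h8 : centeredWalk P x (t n) = centeredWalk P x s + centeredWalk P (shift s x) l := by
      rw [hl, centeredWalk_add]
    rw [h7, h8, add_sub_add_left_eq_sub]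
    exact (abs_sub _ _).trans_lt (by linarith)
  · filter_upwards [h.eventually_time_pos] with n hn
    have : (0 : ℝ) < t n := by exact_mod_cast hn
    positivity
  · have h1 := h.tendsto_div_sqrt_mul.2.const_mul (4 / ε ^ 2)
    rw [mul_zero] at h1
    refine squeeze_zero' (Eventually.of_forall fun n => by positivity) ?_ h1
    filter_upwards [h.eventually_time_pos, hb0] with n hn hbn
    have ht : (0 : ℝ) < t n := by exact_mod_cast hn
    rw [mul_pow, Real.sq_sqrt ht.le]
    have : (L n : ℝ) ≤ b n := Nat.floor_le hbn.le
    calc (L n : ℝ) / ((ε / 2) ^ 2 * t n) ≤ b n / ((ε / 2) ^ 2 * t n) := by gcongr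
      _ = 4 / ε ^ 2 * (b n / t n) := by field_simp; ring

lemma tendsto_centeredWalk_mul (h2 : MemLp id 2 P) (h : Regime t Δ) {c : ℕ → ℝ}
    (hc : Tendsto c atTop (𝓝 0)) :
    Tendsto (fun z : ℕ × (ℕ → ℝ) => centeredWalk P z.2 (t z.1) / √(t z.1) * c z.1)
      (whp (pathLaw P)) (𝓝 0) := by
  refine tendsto_whp_zero_iff.2 fun ε hε => ?_
  -- The extra summand keeps `d` positive where `c` vanishes, so that `d` can be a denominator.
  set d : ℕ → ℝ := fun n => |c n| + 1 / ((n : ℝ) + 1) with hd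
  have hd0 : ∀ n, 0 < d n := fun n => by simp only [hd]; positivity
  have hdt : Tendsto d atTop (𝓝 0) := by
    have := hc.abs.add (tendsto_one_div_add_atTop_nhds_zero_nat (𝕜 := ℝ))
    rwa [abs_zero, add_zero] at this
  have hspos : ∀ᶠ n in atTop, 0 < √(t n : ℝ) := h.tendsto_sqrt.eventually_gt_atTop 0
  have e1 := eventually_abs_centeredWalk_lt h2 (fun _ => 0) t
    (r := fun n => ε * √(t n) / d n) ?_ ?_
  · filter_upwards [e1, tendsto_fst_whp.eventually hspos] with ⟨n, x⟩ h1 hs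
    have h3 := h1 (t n) le_rfl
    dsimp only at *
    rw [shift_zero, lt_div_iff₀ (hd0 n)] at h3
    rw [abs_mul, abs_div, abs_of_pos hs, div_mul_eq_mul_div, div_lt_iff₀ hs]
    refine lt_of_le_of_lt (mul_le_mul_of_nonneg_left ?_ (abs_nonneg _)) h3
    simp only [hd, le_add_iff_nonneg_right]
    positivity
  · filter_upwards [hspos] with n hn
    have := hd0 n
    positivity
  · have h1 := (hdt.pow 2).const_mul (1 / ε ^ 2)
    rw [zero_pow two_ne_zero, mul_zero] at h1
    refine h1.congr' ?_
    filter_upwards [h.eventually_time_pos] with n hn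
    have ht : (0 : ℝ) < t n := by exact_mod_cast hn
    have := hd0 n
    rw [div_pow, mul_pow, Real.sq_sqrt ht.le]
    field_simp

/-- Overshoots are nonnegative, so `Δ N ≤ S_T`, and the maximal inequality gives `S_T ≤ μ T + μ t`.
-/
lemma eventually_mul_msgCount_le (h2 : MemLp id 2 P) (hpos : 0 < ∫ y, y ∂P) (h : Regime t Δ) :
    ∀ᶠ z in whp (pathLaw P),
      Δ z.1 * msgCount (Δ z.1) z.2 (t z.1) ≤ 2 * (∫ y, y ∂P) * t z.1 := by
  set μ := ∫ y, y ∂P with hμ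
  have htR : Tendsto (fun n => (t n : ℝ)) atTop atTop :=
    tendsto_natCast_atTop_atTop.comp h.tendsto_time
  have e1 := eventually_abs_centeredWalk_lt h2 (fun _ => 0) t (r := fun n => μ * t n) ?_ ?_
  · filter_upwards [e1, eventually_mem_driftPaths h2 hpos,
      tendsto_fst_whp.eventually h.eventually_time_pos] with ⟨n, x⟩ h1 hx h4
    dsimp only at *
    have hlt := (msgCount_spec (h.pos n) hx h4).1
    have h3 := (abs_lt.1 (h1 _ hlt.le)).2
    have h5 := mul_le_walk_epoch (Δ n) hx (msgCount (Δ n) x (t n))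
    rw [centeredWalk, shift_zero, ← hμ] at h3
    have h6 : (epoch (Δ n) x (msgCount (Δ n) x (t n)) : ℝ) * μ ≤ t n * μ :=
      mul_le_mul_of_nonneg_right (by exact_mod_cast hlt.le) hpos.le
    linarith
  · filter_upwards [htR.eventually_gt_atTop 0] with n hn using by positivity
  · have h1 : Tendsto (fun n => 1 / μ ^ 2 * (t n : ℝ)⁻¹) atTop (𝓝 (1 / μ ^ 2 * 0)) :=
      (tendsto_inv_atTop_zero.comp htR).const_mul _
    rw [mul_zero] at h1
    refine h1.congr' ?_
    filter_upwards [htR.eventually_gt_atTop 0] with n hn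
    field_simp

lemma tendsto_walk_lastComm_sub (h2 : MemLp id 2 P) (hpos : 0 < ∫ y, y ∂P) (h : Regime t Δ) :
    Tendsto (fun z : ℕ × (ℕ → ℝ) => (walk z.2 (lastComm (Δ z.1) z.2 (t z.1)) -
      msgCount (Δ z.1) z.2 (t z.1) * (Δ z.1 + meanOvershoot P (Δ z.1))) / √(t z.1))
      (whp (pathLaw P)) (𝓝 0) := by
  refine tendsto_whp_zero_iff.2 fun ε hε => ?_
  set μ := ∫ y, y ∂P with hμ
  set L : ℕ → ℕ := fun n => ⌊2 * μ * t n / Δ n⌋₊ with hL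
  have e1 : ∀ᶠ z in whp (pathLaw P), ∀ k ≤ L z.1,
      |walk z.2 (epoch (Δ z.1) z.2 k) - k * (Δ z.1 + meanOvershoot P (Δ z.1))| <
        ε * √(t z.1) := by
    refine eventually_whp.2 <| ENNReal.tendsto_nhds_zero.2 fun η hη => ?_
    obtain ⟨η', hη', hle⟩ : ∃ η' : ℝ, 0 < η' ∧ ENNReal.ofReal η' ≤ η := by
      obtain ⟨q, hq0, hq⟩ := ENNReal.lt_iff_exists_nnreal_btwn.1 hη
      exact ⟨q, by exact_mod_cast hq0, by simpa using hq.le⟩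
    have hδ : 0 < η' * ε ^ 2 / (4 * μ) := by positivity
    -- With at most `2 μ t / Δ` messages and second moment at most `A + δ Δ ≤ 2 δ Δ`, the maximal
    -- inequality bounds the probability by `4 μ δ / ε² = η'`.
    set δ := η' * ε ^ 2 / (4 * μ) with hδdef
    obtain ⟨A, hA, hmeas⟩ := exists_measure_exists_le_abs_walk_epoch_sub h2 hpos hδ
    filter_upwards [h.tendsto_threshold.eventually_ge_atTop (A / δ), h.eventually_time_pos]
      with n hn hn0
    have ht : (0 : ℝ) < t n := by exact_mod_cast hn0
    have hD := h.pos n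
    have h3 := hmeas (Δ n) hD (ε * √(t n)) (by positivity) (L n)
    have hset : {x : ℕ → ℝ | ¬∀ k ≤ L n,
        |walk x (epoch (Δ n) x k) - k * (Δ n + meanOvershoot P (Δ n))| < ε * √(t n)} =
        {x | ∃ k ≤ L n, ε * √(t n) ≤
          |walk x (epoch (Δ n) x k) - k * (Δ n + meanOvershoot P (Δ n))|} := by
      ext x; simp
    rw [hset]
    refine (h3.trans (ENNReal.ofReal_le_ofReal ?_)).trans hle
    have hLn : (L n : ℝ) ≤ 2 * μ * t n / Δ n := Nat.floor_le (by positivity)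
    have hAn : A ≤ δ * Δ n := by rw [mul_comm]; exact (div_le_iff₀ hδ).1 hn
    rw [mul_pow, Real.sq_sqrt ht.le, div_le_iff₀ (by positivity)]
    calc (L n : ℝ) * (A + δ * Δ n) ≤ 2 * μ * t n / Δ n * (δ * Δ n + δ * Δ n) := by gcongr
      _ = η' * (ε ^ 2 * t n) := by rw [hδdef]; field_simp; ring
  filter_upwards [e1, eventually_mul_msgCount_le h2 hpos h, eventually_mem_driftPaths h2 hpos,
    tendsto_fst_whp.eventually h.eventually_time_pos] with ⟨n, x⟩ h1 h3 hx h4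
  dsimp only at *
  have hs : 0 < √(t n : ℝ) := Real.sqrt_pos.2 (by exact_mod_cast h4)
  rw [abs_div, abs_of_pos hs, div_lt_iff₀ hs, lastComm_eq_epoch _ hx]
  refine h1 _ (Nat.le_floor ?_)
  rw [le_div_iff₀ (h.pos n), mul_comm]
  exact h3

/-- The corrected estimator `muHat * (1 + m / Δ)`, where `m` is the mean overshoot, is
asymptotically equivalent to the sample mean. -/
theorem tendsto_muHat_sub (h2 : MemLp id 2 P) (hpos : 0 < ∫ y, y ∂P) (h : Regime t Δ) :
    Tendsto (fun z : ℕ × (ℕ → ℝ) => √(t z.1) * (muHat (Δ z.1) z.2 (t z.1) *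
      (1 + meanOvershoot P (Δ z.1) / Δ z.1) - ∫ y, y ∂P) -
        centeredWalk P z.2 (t z.1) / √(t z.1)) (whp (pathLaw P)) (𝓝 0) := by
  set μ := ∫ y, y ∂P with hμ
  have htR : ∀ᶠ n in atTop, (0 : ℝ) < t n := h.eventually_time_pos.mono fun n hn => by
    exact_mod_cast hn
  have hb0 : ∀ᶠ n in atTop, 0 < √(Δ n * t n) := htR.mono fun n hn => by
    have := h.pos n
    positivity
  have l1 := tendsto_centeredWalk_lastComm_sub h2 hpos h
  have l2 := tendsto_walk_lastComm_sub h2 hpos h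
  have l3 := tendsto_sub_lastComm_div h2 hpos h hb0 h.tendsto_div_sqrt_mul.1
  have l4 := tendsto_centeredWalk_mul h2 h h.tendsto_div_sqrt_mul.2
  have l5 : Tendsto (fun z : ℕ × (ℕ → ℝ) => (lastComm (Δ z.1) z.2 (t z.1) : ℝ) / t z.1)
      (whp (pathLaw P)) (𝓝 1) := by
    have := (tendsto_sub_lastComm_div h2 hpos h htR h.ratio).const_sub 1
    rw [sub_zero] at this
    refine this.congr' ?_
    filter_upwards [tendsto_fst_whp.eventually htR] with z hz
    field_simp
    ring
  have l6 := l5.inv₀ one_ne_zero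
  -- With `b = √(Δ t)`, the quantity in the goal equals `(t/T) [(Z_T - Z_t)/√t - (S_T - N (Δ +
  -- m))/√t + ((t - T)/b) (Z_t/√t) (b/t)]`.
  have l := l6.mul ((l1.sub l2).add (l3.mul l4))
  simp only [sub_zero, mul_zero, add_zero] at l
  refine l.congr' ?_
  filter_upwards [tendsto_fst_whp.eventually htR, tendsto_fst_whp.eventually hb0,
    l5.eventually_const_lt (show (0 : ℝ) < 1 by norm_num)] with ⟨n, x⟩ ht hb hT
  dsimp only at *
  have hD := h.pos n
  have hs : 0 < √(t n : ℝ) := Real.sqrt_pos.2 ht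
  have hT' : (0 : ℝ) < lastComm (Δ n) x (t n) := by
    by_contra hcon
    exact absurd hT (not_lt.2 (div_nonpos_of_nonpos_of_nonneg (not_lt.1 hcon) ht.le))
  rw [muHat]
  simp only [centeredWalk, ← hμ]
  generalize (lastComm (Δ n) x (t n)) = T at *
  generalize (msgCount (Δ n) x (t n) : ℝ) = N
  generalize √(Δ n * t n) = b at *
  generalize meanOvershoot P (Δ n) = m
  have hts : (t n : ℝ) = √(t n : ℝ) * √(t n : ℝ) := (Real.mul_self_sqrt ht.le).symm
  generalize √(t n : ℝ) = r at *
  rw [hts] at *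
  field_simp
  ring

/-- Dividing by `t` instead of `T` adds the error `μ (t - T)/√t`, which vanishes because `Δ ≪ √t`.
-/
theorem tendsto_muCheck_sub (h2 : MemLp id 2 P) (hpos : 0 < ∫ y, y ∂P) (h : Regime t Δ)
    (hs : Tendsto (fun n => Δ n / √(t n)) atTop (𝓝 0)) :
    Tendsto (fun z : ℕ × (ℕ → ℝ) => √(t z.1) * (muCheck (Δ z.1) z.2 (t z.1) *
      (1 + meanOvershoot P (Δ z.1) / Δ z.1) - ∫ y, y ∂P) -
        centeredWalk P z.2 (t z.1) / √(t z.1)) (whp (pathLaw P)) (𝓝 0) := by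
  set μ := ∫ y, y ∂P with hμ
  have htR : ∀ᶠ n in atTop, (0 : ℝ) < t n := h.eventually_time_pos.mono fun n hn => by
    exact_mod_cast hn
  have hs0 : ∀ᶠ n in atTop, 0 < √(t n : ℝ) := h.tendsto_sqrt.eventually_gt_atTop 0
  have l := ((tendsto_centeredWalk_lastComm_sub h2 hpos h).sub
    (tendsto_walk_lastComm_sub h2 hpos h)).sub
    ((tendsto_sub_lastComm_div h2 hpos h hs0 hs).const_mul μ)
  simp only [sub_zero, mul_zero] at l
  refine l.congr' ?_
  filter_upwards [tendsto_fst_whp.eventually htR] with ⟨n, x⟩ ht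
  dsimp only at *
  have hD := h.pos n
  have hs : 0 < √(t n : ℝ) := Real.sqrt_pos.2 ht
  rw [muCheck]
  simp only [centeredWalk, ← hμ]
  generalize (lastComm (Δ n) x (t n)) = T
  generalize (msgCount (Δ n) x (t n) : ℝ) = N
  generalize meanOvershoot P (Δ n) = m
  have hts : (t n : ℝ) = √(t n : ℝ) * √(t n : ℝ) := (Real.mul_self_sqrt ht.le).symm
  generalize √(t n : ℝ) = r at *
  rw [hts] at *
  field_simp
  ring

end

end SensorFusion

namespace SensorFusion

/-! ### Replacing the mean overshoot by its estimate -/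

section

variable {α : Type*} {F : Filter α} {r D m Y Z : α → ℝ} {μ : ℝ}

lemma tendsto_of_tendsto_scaled (hr : Tendsto r F atTop) (hm : Tendsto (fun z => m z / D z) F (𝓝 0))
    (hZ : Tendsto (fun z => Z z / r z) F (𝓝 0))
    (H : Tendsto (fun z => r z * (Y z * (1 + m z / D z) - μ) - Z z) F (𝓝 0)) :
    Tendsto Y F (𝓝 μ) := by
  have h1 := ((H.mul (tendsto_inv_atTop_zero.comp hr)).add hZ).add_const μ
  have h2 := h1.mul ((hm.const_add 1).inv₀ (by norm_num))
  simp only [mul_zero, add_zero, zero_add, inv_one, mul_one] at h2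
  refine h2.congr' ?_
  filter_upwards [hr.eventually_gt_atTop 0, hm.eventually_const_lt (show (-1 : ℝ) < 0 by norm_num)]
    with z hz hz'
  have h3 : 1 + m z / D z ≠ 0 := by linarith
  generalize 1 + m z / D z = q at *
  simp only [Function.comp]
  field_simp
  ring

/-- Dropping the factor costs `Y · r m / D`, where `Y` converges to `μ`. -/
lemma tendsto_scaled_of_tendsto_mean (hr : Tendsto r F atTop)
    (hm : Tendsto (fun z => m z / D z) F (𝓝 0)) (hrm : Tendsto (fun z => r z * (m z / D z)) F (𝓝 0))
    (hZ : Tendsto (fun z => Z z / r z) F (𝓝 0))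
    (H : Tendsto (fun z => r z * (Y z * (1 + m z / D z) - μ) - Z z) F (𝓝 0)) :
    Tendsto (fun z => r z * (Y z - μ) - Z z) F (𝓝 0) := by
  have hY := tendsto_of_tendsto_scaled hr hm hZ H
  have h := H.sub (hY.mul hrm)
  rw [mul_zero, sub_zero] at h
  exact h.congr fun z => by ring

/-- The error to control is `Y · r (ρ(Y) - m) / D`. Splitting at `ρ(μ)` leaves `r (m - ρ(μ)) / D`
and, by the Lipschitz bound, a multiple of `r |Y - μ| / D`. The latter vanishes because `r (Y - μ)`
equals `Z - Y · r m / D` up to `o(1)`, and both terms are negligible after division by `D`. -/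
lemma tendsto_scaled_correct (hμ : 0 < μ) {ρ : ℝ → ℝ} {C : ℝ≥0}
    (hρ : LipschitzOnWith C ρ (Set.Ioi 0)) (hr : Tendsto r F atTop)
    (hD : ∀ z, 0 < D z)
    (hm : Tendsto (fun z => m z / D z) F (𝓝 0))
    (hrm : Tendsto (fun z => r z * (m z / D z) / D z) F (𝓝 0))
    (hrρ : Tendsto (fun z => r z * (m z - ρ μ) / D z) F (𝓝 0))
    (hZ : Tendsto (fun z => Z z / r z) F (𝓝 0)) (hZD : Tendsto (fun z => Z z / D z) F (𝓝 0))
    (hDinv : Tendsto (fun z => (D z)⁻¹) F (𝓝 0))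
    (H : Tendsto (fun z => r z * (Y z * (1 + m z / D z) - μ) - Z z) F (𝓝 0)) :
    Tendsto (fun z => r z * (correct ρ (D z) (Y z) - μ) - Z z) F (𝓝 0) := by
  have hY := tendsto_of_tendsto_scaled hr hm hZ H
  have h1 : Tendsto (fun z => r z * (Y z - μ) / D z) F (𝓝 0) := by
    have h := ((H.mul hDinv).add hZD).sub (hY.mul hrm)
    simp only [mul_zero, add_zero, sub_zero] at h
    refine h.congr fun z => ?_
    have := hD z
    field_simp
    ring
  have h2 : Tendsto (fun z => r z * (ρ (Y z) - ρ μ) / D z) F (𝓝 0) := by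
    have h := h1.abs.const_mul (C : ℝ)
    rw [abs_zero, mul_zero] at h
    refine squeeze_zero_norm' ?_ h
    filter_upwards [hY.eventually_const_lt hμ] with z hz
    have h3 := hρ.dist_le_mul (Y z) hz μ hμ
    rw [Real.dist_eq, Real.dist_eq] at h3
    rw [Real.norm_eq_abs, abs_div, abs_div, abs_mul, abs_mul, ← mul_div_assoc]
    refine div_le_div_of_nonneg_right ?_ (abs_nonneg _)
    calc |r z| * |ρ (Y z) - ρ μ| ≤ |r z| * (C * |Y z - μ|) := by gcongr
      _ = C * (|r z| * |Y z - μ|) := by ring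
  have h := H.add (hY.mul (h2.sub hrρ))
  simp only [mul_zero, add_zero, sub_zero] at h
  refine h.congr fun z => ?_
  have := hD z
  rw [correct]
  field_simp
  ring

end

section

variable {P : Measure ℝ} [IsProbabilityMeasure P] {t : ℕ → ℕ} {Δ : ℕ → ℝ}

lemma Regime.tendsto_mean_div (h : Regime t Δ) (h2 : MemLp id 2 P) (hpos : 0 < ∫ y, y ∂P)
    {c : ℕ → ℝ} (hc : Tendsto (fun n => c n / Δ n) atTop (𝓝 0)) (hc0 : ∀ n, 0 ≤ c n) :
    Tendsto (fun n => c n * (meanOvershoot P (Δ n) / Δ n)) atTop (𝓝 0) := by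
  obtain ⟨A, hA, hle⟩ := exists_meanOvershoot_le h2 hpos
  have h1 := hc.const_mul A
  rw [mul_zero] at h1
  refine squeeze_zero (fun n => ?_) (fun n => ?_) h1
  · have := h.pos n
    have := hc0 n
    have := meanOvershoot_nonneg (integrable_id_of_memLp h2) hpos (Δ n)
    positivity
  · have h3 := hle _ (h.pos n)
    have h4 : 0 ≤ c n / Δ n := div_nonneg (hc0 n) (h.pos n).le
    calc c n * (meanOvershoot P (Δ n) / Δ n) = meanOvershoot P (Δ n) * (c n / Δ n) := by ring
      _ ≤ A * (c n / Δ n) := by gcongr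

lemma Regime.tendsto_inv (h : Regime t Δ) : Tendsto (fun n => (Δ n)⁻¹) atTop (𝓝 0) :=
  tendsto_inv_atTop_zero.comp h.tendsto_threshold

lemma Regime.tendsto_mean_div_threshold (h : Regime t Δ) (h2 : MemLp id 2 P)
    (hpos : 0 < ∫ y, y ∂P) : Tendsto (fun n => meanOvershoot P (Δ n) / Δ n) atTop (𝓝 0) := by
  have := h.tendsto_mean_div h2 hpos (c := fun _ => 1)
    (h.tendsto_inv.congr fun n => by rw [one_div]) fun _ => zero_le_one
  simpa using this

lemma Regime.tendsto_centeredWalk_div (h : Regime t Δ) (h2 : MemLp id 2 P) {c : ℕ → ℝ}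
    (hc : Tendsto c atTop atTop) :
    Tendsto (fun z : ℕ × (ℕ → ℝ) => centeredWalk P z.2 (t z.1) / √(t z.1) / c z.1)
      (whp (pathLaw P)) (𝓝 0) :=
  (tendsto_centeredWalk_mul h2 h (tendsto_inv_atTop_zero.comp hc)).congr fun z => by
    rw [div_eq_mul_inv _ (c z.1)]; rfl

theorem tendsto_scaled_estimator (h2 : MemLp id 2 P) (hpos : 0 < ∫ y, y ∂P) (h : Regime t Δ)
    (hs : Tendsto (fun n => √(t n) / Δ n) atTop (𝓝 0)) {Y : ℕ × (ℕ → ℝ) → ℝ}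
    (H : Tendsto (fun z => √(t z.1) * (Y z * (1 + meanOvershoot P (Δ z.1) / Δ z.1) -
      ∫ y, y ∂P) - centeredWalk P z.2 (t z.1) / √(t z.1)) (whp (pathLaw P)) (𝓝 0)) :
    Tendsto (fun z => √(t z.1) * (Y z - ∫ y, y ∂P) - centeredWalk P z.2 (t z.1) / √(t z.1))
      (whp (pathLaw P)) (𝓝 0) := by
  have l1 := h.tendsto_sqrt.comp (tendsto_fst_whp (Q := pathLaw P))
  have l2 := (h.tendsto_mean_div_threshold h2 hpos).comp (tendsto_fst_whp (Q := pathLaw P))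
  have l3 := (h.tendsto_mean_div h2 hpos (c := fun n => √(t n)) hs
    fun _ => Real.sqrt_nonneg _).comp (tendsto_fst_whp (Q := pathLaw P))
  have l4 := h.tendsto_centeredWalk_div h2 h.tendsto_sqrt
  exact tendsto_scaled_of_tendsto_mean l1 l2 l3 l4 H

theorem tendsto_scaled_correct_estimator {F : ℝ → Measure ℝ} {μ : ℝ} (hμ : 0 < μ)
    [IsProbabilityMeasure (F μ)] (h2 : MemLp id 2 (F μ)) (hmean : ∫ y, y ∂(F μ) = μ)
    (hF : OvershootConditions F μ) (h : Regime t Δ)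
    (hs : Tendsto (fun n => √(t n) / Δ n / Δ n) atTop (𝓝 0)) {Y : ℕ × (ℕ → ℝ) → ℝ}
    (H : Tendsto (fun z => √(t z.1) * (Y z * (1 + meanOvershoot (F μ) (Δ z.1) / Δ z.1) -
      ∫ y, y ∂(F μ)) - centeredWalk (F μ) z.2 (t z.1) / √(t z.1)) (whp (pathLaw (F μ))) (𝓝 0)) :
    Tendsto (fun z => √(t z.1) * (correct (rho F) (Δ z.1) (Y z) - ∫ y, y ∂(F μ)) -
      centeredWalk (F μ) z.2 (t z.1) / √(t z.1)) (whp (pathLaw (F μ))) (𝓝 0) := by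
  obtain ⟨C, hC⟩ := hF.lipschitz
  obtain ⟨r, hr, hrate⟩ := hF.rate
  have hpos : 0 < ∫ y, y ∂(F μ) := by rw [hmean]; exact hμ
  have hrm : Tendsto (fun n => √(t n) * (meanOvershoot (F μ) (Δ n) / Δ n) / Δ n) atTop (𝓝 0) := by
    have := h.tendsto_mean_div h2 hpos (c := fun n => √(t n) / Δ n) hs
      fun n => div_nonneg (Real.sqrt_nonneg _) (h.pos n).le
    exact this.congr fun n => by ring
  have hrρ : Tendsto (fun n => √(t n) * (meanOvershoot (F μ) (Δ n) - rho F μ) / Δ n)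
      atTop (𝓝 0) := by
    obtain ⟨c, hc0, hc⟩ := (hrate.comp_tendsto h.tendsto_threshold).exists_pos
    have h1 := hs.const_mul c
    rw [mul_zero] at h1
    refine squeeze_zero_norm' ?_ h1
    filter_upwards [hc.bound, h.tendsto_threshold.eventually_ge_atTop 1] with n hn hn1
    have hD := h.pos n
    simp only [Function.comp] at hn
    -- As `r ≥ 2`, the rate is at least `1/Δ`; the error is then of order `√t/Δ²`.
    have h3 : ‖Δ n ^ (-(r - 1))‖ ≤ (Δ n)⁻¹ := by
      rw [Real.norm_of_nonneg (by positivity), ← Real.rpow_neg_one]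
      exact Real.rpow_le_rpow_of_exponent_le hn1 (by linarith)
    rw [norm_div, norm_mul, Real.norm_of_nonneg hD.le, Real.norm_of_nonneg (Real.sqrt_nonneg _)]
    calc √(t n) * ‖meanOvershoot (F μ) (Δ n) - rho F μ‖ / Δ n
        ≤ √(t n) * (c * (Δ n)⁻¹) / Δ n := by
          gcongr; exact hn.trans (by gcongr)
      _ = c * (√(t n) / Δ n / Δ n) := by ring
  rw [hmean] at H ⊢
  have l1 := h.tendsto_sqrt.comp (tendsto_fst_whp (Q := pathLaw (F μ)))
  have l2 := (h.tendsto_mean_div_threshold h2 hpos).comp (tendsto_fst_whp (Q := pathLaw (F μ)))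
  have l3 := hrm.comp (tendsto_fst_whp (Q := pathLaw (F μ)))
  have l4 := hrρ.comp (tendsto_fst_whp (Q := pathLaw (F μ)))
  have l5 := h.tendsto_centeredWalk_div h2 h.tendsto_sqrt
  have l6 := h.tendsto_centeredWalk_div h2 h.tendsto_threshold
  have l7 := h.tendsto_inv.comp (tendsto_fst_whp (Q := pathLaw (F μ)))
  exact tendsto_scaled_correct hμ hC l1 (fun z => h.pos z.1) l2 l3 l4 l5 l6 l7 H

/-- On paths drifting to infinity the supremum defining `msgCount` is the first `n` whose next epoch
is at least `t`, and this index is measurable. The function `f` is arbitrary because `ℕ × ℕ` is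
discrete, so no regularity of `ρ` is involved. -/
lemma aemeasurable_msgCount_lastComm (h2 : MemLp id 2 P) (hpos : 0 < ∫ y, y ∂P) {a : ℝ}
    (ha : 0 < a) (t : ℕ) (f : ℕ × ℕ → ℝ) :
    AEMeasurable (fun x => f (msgCount a x t, lastComm a x t)) (pathLaw P) := by
  set N : (ℕ → ℝ) → ℕ := fun x => sInf {n | t ≤ epoch a x (n + 1)}
  have hN : Measurable N :=
    measurable_sInf_nat fun n => measurableSet_le measurable_const (measurable_epoch a (n + 1))
  have hT : Measurable fun x => epoch a x (N x) :=
    measurable_apply_nat (f := fun n x => epoch a x n) (measurable_epoch a) hN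
  refine ⟨fun x => f (N x, epoch a x (N x)),
    (Measurable.of_discrete (f := f)).comp (hN.prodMk hT), ?_⟩
  filter_upwards [ae_mem_driftPaths (integrable_id_of_memLp h2) hpos] with x hx
  have hNx : msgCount a x t = N x := by
    rcases Nat.eq_zero_or_pos t with rfl | ht
    · simp [N, msgCount]
    · obtain ⟨h1, h3⟩ := msgCount_spec ha hx ht
      refine le_antisymm (le_csInf ⟨_, h3⟩ fun n hn => ?_) (Nat.sInf_le h3)
      by_contra hcon
      have := (strictMono_epoch ha hx).monotone (show n + 1 ≤ msgCount a x t by omega)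
      have : t ≤ epoch a x (n + 1) := hn
      omega
  rw [lastComm_eq_epoch a hx, hNx]

end

/-! ### The central limit theorem for the fused sum -/

section

variable {Ω : Type*} [MeasurableSpace Ω] {Pr : Measure Ω} {K : ℕ}
  {X : Fin K → ℕ → Ω → ℝ} {σ : Fin K → ℝ} {μ : ℝ}

lemma map_path (hX : ∀ k i, Measurable (X k i))
    (hindep : iIndepFun (fun p : Fin K × ℕ => X p.1 p.2) Pr)
    (hident : ∀ k i, IdentDistrib (X k i) (X k 0) Pr Pr) (k : Fin K) :
    Pr.map (fun ω i => X k i ω) = pathLaw (Pr.map (X k 0)) := by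
  have h : iIndepFun (fun i => X k i) Pr :=
    hindep.precomp (g := fun i : ℕ => (k, i)) fun i j hij => by simpa using hij
  rw [h.map_fun_eq_infinitePi_map (hX k)]
  simp_rw [fun i => (hident k i).map_eq]

variable [IsProbabilityMeasure Pr]

/-- Regrouping the independent family by time: the vectors of simultaneous observations are i.i.d.,
which makes their weighted sums i.i.d. for the central limit theorem. -/
lemma map_snapshots (hX : ∀ k i, Measurable (X k i))
    (hindep : iIndepFun (fun p : Fin K × ℕ => X p.1 p.2) Pr)
    (hident : ∀ k i, IdentDistrib (X k i) (X k 0) Pr Pr) :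
    Pr.map (fun ω i k => X k i ω) =
      Measure.infinitePi fun _ : ℕ => Measure.infinitePi fun k => Pr.map (X k 0) := by
  have hp : ∀ k i, IsProbabilityMeasure (Pr.map (X k i)) := fun k i =>
    Measure.isProbabilityMeasure_map (hX k i).aemeasurable
  have h : iIndepFun (fun p : ℕ × Fin K => X p.2 p.1) Pr :=
    hindep.precomp (g := fun p : ℕ × Fin K => (p.2, p.1)) fun p q hpq =>
      Prod.ext (congrArg Prod.snd hpq) (congrArg Prod.fst hpq)
  have hm : Measurable fun ω (p : ℕ × Fin K) => X p.2 p.1 ω :=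
    measurable_pi_iff.2 fun p => hX p.2 p.1
  have h1 := h.map_fun_eq_infinitePi_map fun p : ℕ × Fin K => hX p.2 p.1
  simp_rw [fun p : ℕ × Fin K => (hident p.2 p.1).map_eq] at h1
  rw [← Measure.infinitePi_map_curry (fun (_ : ℕ) k => Pr.map (X k 0)), ← h1,
    Measure.map_map (by fun_prop) hm]
  rfl

lemma map_snapshot (hX : ∀ k i, Measurable (X k i))
    (hindep : iIndepFun (fun p : Fin K × ℕ => X p.1 p.2) Pr)
    (hident : ∀ k i, IdentDistrib (X k i) (X k 0) Pr Pr) (i : ℕ) :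
    Pr.map (fun ω k => X k i ω) = Measure.infinitePi fun k => Pr.map (X k 0) := by
  have hp : ∀ k, IsProbabilityMeasure (Pr.map (X k 0)) := fun k =>
    Measure.isProbabilityMeasure_map (hX k 0).aemeasurable
  have h := congrArg (Measure.map fun y : ℕ → Fin K → ℝ => y i) (map_snapshots hX hindep hident)
  rw [Measure.infinitePi_map_eval, Measure.map_map (by fun_prop) (by fun_prop)] at h
  exact h

lemma iIndepFun_snapshot (hX : ∀ k i, Measurable (X k i))
    (hindep : iIndepFun (fun p : Fin K × ℕ => X p.1 p.2) Pr)
    (hident : ∀ k i, IdentDistrib (X k i) (X k 0) Pr Pr) :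
    iIndepFun (fun i ω k => X k i ω) Pr := by
  rw [iIndepFun_iff_map_fun_eq_infinitePi_map (by fun_prop), map_snapshots hX hindep hident]
  simp_rw [map_snapshot hX hindep hident]

lemma sum_weight [Nonempty (Fin K)] (hσ : ∀ k, 0 < σ k) : ∑ k, weight σ k = 1 := by
  have h : 0 < ∑ j, (σ j ^ 2)⁻¹ :=
    Finset.sum_pos (fun j _ => by have := hσ j; positivity) Finset.univ_nonempty
  simp only [weight]
  rw [← Finset.sum_div, div_self h.ne']

lemma weight_pos [Nonempty (Fin K)] (hσ : ∀ k, 0 < σ k) (k : Fin K) : 0 < weight σ k := by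
  have h : 0 < ∑ j, (σ j ^ 2)⁻¹ :=
    Finset.sum_pos (fun j _ => by have := hσ j; positivity) Finset.univ_nonempty
  have := hσ k
  rw [weight]
  positivity

lemma fusedSD_pos [Nonempty (Fin K)] (hσ : ∀ k, 0 < σ k) : 0 < fusedSD σ :=
  Real.sqrt_pos.2 <| Finset.sum_pos (fun k _ => by
    have := hσ k; have := weight_pos hσ k; positivity) Finset.univ_nonempty

/-- The optimal linear estimator is asymptotically normal. -/
theorem tendstoInDistribution_fused_sum [Nonempty (Fin K)] (hX : ∀ k i, Measurable (X k i))
    (hindep : iIndepFun (fun p : Fin K × ℕ => X p.1 p.2) Pr)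
    (hident : ∀ k i, IdentDistrib (X k i) (X k 0) Pr Pr) (hσ : ∀ k, 0 < σ k)
    (hL2 : ∀ k, MemLp (X k 0) 2 Pr) (hmean : ∀ k, ∫ ω, X k 0 ω ∂Pr = μ)
    (hvar : ∀ k, variance (X k 0) Pr = σ k ^ 2) :
    TendstoInDistribution (fun (n : ℕ) ω =>
      (√n)⁻¹ * (∑ i ∈ Finset.range n, ∑ k, weight σ k * X k i ω - n * μ) / fusedSD σ) atTop
      (id : ℝ → ℝ) (fun _ => Pr) (gaussianReal 0 1) := by
  set W : ℕ → Ω → ℝ := fun i ω => ∑ k, weight σ k * X k i ω with hW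
  have hg : Measurable fun y : Fin K → ℝ => ∑ k, weight σ k * y k := by fun_prop
  have hWi : iIndepFun W Pr :=
    (iIndepFun_snapshot hX hindep hident).comp (fun _ y => ∑ k, weight σ k * y k) fun _ => hg
  have hWd : ∀ i, IdentDistrib (W i) (W 0) Pr Pr := fun i => by
    have : IdentDistrib (fun ω k => X k i ω) (fun ω k => X k 0 ω) Pr Pr :=
      ⟨by fun_prop, by fun_prop, by rw [map_snapshot hX hindep hident,
        map_snapshot hX hindep hident]⟩
    exact this.comp hg
  have hL : ∀ k, MemLp (fun ω => weight σ k * X k 0 ω) 2 Pr := fun k => (hL2 k).const_mul _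
  have hW2 : MemLp (W 0) 2 Pr := memLp_finsetSum _ fun k _ => hL k
  have hWm : ∫ ω, W 0 ω ∂Pr = μ := by
    rw [hW]
    dsimp only
    rw [integral_finsetSum _ fun k _ => (hL k).integrable (by norm_num)]
    simp_rw [integral_const_mul, hmean]
    rw [← Finset.sum_mul, sum_weight hσ, one_mul]
  have hWv : variance (W 0) Pr = fusedSD σ ^ 2 := by
    have e : W 0 = ∑ k, fun ω => weight σ k * X k 0 ω := by ext ω; simp [hW]
    rw [e, IndepFun.variance_sum (fun k _ => hL k), fusedSD, Real.sq_sqrt]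
    · simp_rw [variance_const_mul, hvar]
    · positivity
    · intro k _ l _ hkl
      have : IndepFun (X k 0) (X l 0) Pr :=
        hindep.indepFun (i := (k, 0)) (j := (l, 0)) (by simpa using hkl)
      exact this.comp (φ := fun y => weight σ k * y) (ψ := fun y => weight σ l * y)
        (by fun_prop) (by fun_prop)
  have hs := fusedSD_pos hσ
  have hlaw : HasLaw (fun y : ℝ => fusedSD σ * y) (gaussianReal 0 (variance (W 0) Pr).toNNReal)
      (gaussianReal 0 1) := by
    refine ⟨by fun_prop, ?_⟩
    rw [gaussianReal_map_const_mul, hWv, mul_zero, mul_one]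
    congr 1
    ext
    simp [Real.coe_toNNReal _ (sq_nonneg (fusedSD σ))]
  have key := (tendstoInDistribution_inv_sqrt_mul_sum_sub hlaw hW2 hWi hWd).continuous_comp
    (g := fun y => y / fusedSD σ) (by fun_prop)
  have e : ((fun y => y / fusedSD σ) ∘ fun y : ℝ => fusedSD σ * y) = id := by
    ext y
    simp only [Function.comp, id]
    field_simp
  rw [e, hWm] at key
  exact key

/-- Estimators that are asymptotically equivalent to the sample means of the sensors fuse to an
asymptotically efficient estimator. -/
theorem asympNormal_of_tendsto [Nonempty (Fin K)] (hX : ∀ k i, Measurable (X k i))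
    (hindep : iIndepFun (fun p : Fin K × ℕ => X p.1 p.2) Pr)
    (hident : ∀ k i, IdentDistrib (X k i) (X k 0) Pr Pr) (hσ : ∀ k, 0 < σ k)
    (hL2 : ∀ k, MemLp (X k 0) 2 Pr) (hmean : ∀ k, ∫ ω, X k 0 ω ∂Pr = μ)
    (hvar : ∀ k, variance (X k 0) Pr = σ k ^ 2) {t : ℕ → ℕ} (ht : Tendsto t atTop atTop)
    {Y : Fin K → ℕ × (ℕ → ℝ) → ℝ}
    (hY : ∀ k n, AEMeasurable (fun x => Y k (n, x)) (pathLaw (Pr.map (X k 0))))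
    (H : ∀ k, Tendsto (fun z => √(t z.1) * (Y k z - ∫ y, y ∂(Pr.map (X k 0))) -
      centeredWalk (Pr.map (X k 0)) z.2 (t z.1) / √(t z.1))
        (whp (pathLaw (Pr.map (X k 0)))) (𝓝 0)) :
    AsympNormal Pr (fun n ω => ∑ k, weight σ k * Y k (n, fun i => X k i ω)) μ (fusedSD σ) t := by
  have hm : ∀ k, ∫ y, y ∂(Pr.map (X k 0)) = μ := fun k => by
    rw [integral_map (hX k 0).aemeasurable (by fun_prop), hmean]
  have hpath : ∀ k, Measurable fun ω i => X k i ω := fun k => measurable_pi_iff.2 (hX k)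
  have hclt := tendstoInDistribution_fused_sum hX hindep hident hσ hL2 hmean hvar
  have hclt' : TendstoInDistribution (fun n ω =>
      (√(t n : ℝ))⁻¹ * (∑ i ∈ Finset.range (t n), ∑ k, weight σ k * X k i ω - t n * μ) /
        fusedSD σ) atTop (id : ℝ → ℝ) (fun _ => Pr) (gaussianReal 0 1) :=
    ⟨fun n => hclt.forall_aemeasurable (t n), hclt.aemeasurable_limit, hclt.tendsto.comp ht⟩
  -- Slutsky's lemma: the difference from the optimal linear estimator is a weighted sum of the
  -- single-sensor errors, using `∑ w_k = 1`.
  refine tendstoInDistribution_of_tendstoInMeasure_sub _ _ hclt' ?_ fun n => ?_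
  · refine tendstoInMeasure_of_tendsto_whp ?_
    have h1 : ∀ k, Tendsto (fun z : ℕ × Ω => weight σ k * (√(t z.1) *
        (Y k (z.1, fun i => X k i z.2) - μ) -
          centeredWalk (Pr.map (X k 0)) (fun i => X k i z.2) (t z.1) / √(t z.1)))
        (whp Pr) (𝓝 0) := fun k => by
      have h := H k
      rw [← map_path hX hindep hident k, hm k] at h
      have h4 := (h.comp (tendsto_map_whp (hpath k))).const_mul (weight σ k)
      rw [mul_zero] at h4
      exact h4
    have h3 := (tendsto_finsetSum Finset.univ fun k _ => h1 k).div_const (fusedSD σ)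
    simp only [Finset.sum_const_zero, zero_div] at h3
    refine h3.congr' ?_
    filter_upwards [tendsto_fst_whp.eventually (ht.eventually_gt_atTop 0)] with ⟨n, ω⟩ hn
    have hr : 0 < √(t n : ℝ) := Real.sqrt_pos.2 (by exact_mod_cast hn)
    have hs := fusedSD_pos hσ
    have e1 : ∑ i ∈ Finset.range (t n), ∑ k, weight σ k * X k i ω - t n * μ =
        ∑ k, weight σ k * centeredWalk (Pr.map (X k 0)) (fun i => X k i ω) (t n) := by
      simp only [centeredWalk, hm, walk, mul_sub, Finset.sum_sub_distrib, Finset.mul_sum]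
      rw [← Finset.sum_mul, sum_weight hσ, one_mul, Finset.sum_comm]
    have e2 : ∑ k, weight σ k * Y k (n, fun i => X k i ω) - μ =
        ∑ k, weight σ k * (Y k (n, fun i => X k i ω) - μ) := by
      simp only [mul_sub, Finset.sum_sub_distrib]
      rw [← Finset.sum_mul, sum_weight hσ, one_mul]
    simp only [Pi.sub_apply, e1, e2, div_div_eq_mul_div, Finset.sum_mul, Finset.mul_sum,
      Finset.sum_div, ← Finset.sum_sub_distrib]
    refine Finset.sum_congr rfl fun k _ => ?_
    field_simp
  · have h : ∀ k, AEMeasurable (fun ω => Y k (n, fun i => X k i ω)) Pr := fun k => by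
      have := hY k n
      rw [← map_path hX hindep hident k] at this
      exact this.comp_measurable (hpath k)
    exact ((Finset.aemeasurable_fun_sum _ fun k _ => (h k).const_mul _).sub_const _).div_const _

end

end SensorFusion

/-! ### Growth conditions on the thresholds, and the fused estimators. -/

namespace SensorFusion

section

variable {K : ℕ} {Δ : ℕ → Fin K → ℝ} {g : ℕ → ℝ}

lemma tendsto_div_of_iSup_isLittleO (hΔ : ∀ n k, 0 < Δ n k) (hg : ∀ n, 0 ≤ g n)
    (h : (fun n => ⨆ k, Δ n k) =o[atTop] g) (k : Fin K) :
    Tendsto (fun n => Δ n k / g n) atTop (𝓝 0) :=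
  squeeze_zero (fun n => div_nonneg (hΔ n k).le (hg n))
    (fun n => div_le_div_of_nonneg_right (le_ciSup (Set.finite_range _).bddAbove k) (hg n))
    h.tendsto_div_nhds_zero

lemma tendsto_div_of_isLittleO_iInf (hΔ : ∀ n k, 0 < Δ n k) (hg : ∀ n, 0 ≤ g n)
    (h : g =o[atTop] fun n => ⨅ k, Δ n k) (k : Fin K) :
    Tendsto (fun n => g n / Δ n k) atTop (𝓝 0) := by
  have : Nonempty (Fin K) := ⟨k⟩
  refine squeeze_zero (fun n => div_nonneg (hg n) (hΔ n k).le) (fun n => ?_)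
    h.tendsto_div_nhds_zero
  -- The infimum over finitely many sensors is attained, hence positive.
  obtain ⟨l, hl⟩ := exists_eq_ciInf_of_finite (f := Δ n)
  exact div_le_div_of_nonneg_left (hg n) (hl ▸ hΔ n l) (ciInf_le (Set.finite_range _).bddBelow k)

lemma regime_of_isLittleO {t : ℕ → ℕ} (hΔ : ∀ n k, 0 < Δ n k) (ht : Tendsto t atTop atTop)
    (hΔt : (fun n => ⨆ k, Δ n k) =o[atTop] fun n => (t n : ℝ)) (hg : Tendsto g atTop atTop)
    (h : g =o[atTop] fun n => ⨅ k, Δ n k) (k : Fin K) : Regime t fun n => Δ n k where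
  pos n := hΔ n k
  tendsto_time := ht
  ratio := tendsto_div_of_iSup_isLittleO hΔ (fun n => Nat.cast_nonneg _) hΔt k
  tendsto_threshold := by
    have h1 := tendsto_div_of_isLittleO_iInf hΔ (fun n => abs_nonneg (g n)) h.abs_left k
    refine tendsto_atTop_mono' _ ?_ hg
    filter_upwards [h1.eventually_le_const zero_lt_one] with n hn
    exact (le_abs_self _).trans ((div_le_one (hΔ n k)).1 hn)

end

end SensorFusion

theorem mainTheorem8 {Ω : Type*} [MeasurableSpace Ω] (Pr : Measure Ω) [IsProbabilityMeasure Pr]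
    (K : ℕ) (hK : 0 < K)
    -- `X k i` is the observation of sensor `k` at time `i + 1`
    (X : Fin K → ℕ → Ω → ℝ) (hX : ∀ k i, Measurable (X k i))
    (hindep : iIndepFun (fun p : Fin K × ℕ => X p.1 p.2) Pr)
    (hident : ∀ k i, IdentDistrib (X k i) (X k 0) Pr Pr)
    (μ : ℝ) (hμ : 0 < μ) (σ : Fin K → ℝ) (hσ : ∀ k, 0 < σ k)
    (hL2 : ∀ k, MemLp (X k 0) 2 Pr) (hmean : ∀ k, ∫ ω, X k 0 ω ∂Pr = μ)
    (hvar : ∀ k, variance (X k 0) Pr = σ k ^ 2)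
    -- times and thresholds along which the limit is taken
    (t : ℕ → ℕ) (ht : Tendsto t atTop atTop)
    (Δ : ℕ → Fin K → ℝ) (hΔ : ∀ n k, 0 < Δ n k)
    (hΔt : (fun n => ⨆ k, Δ n k) =o[atTop] fun n => (t n : ℝ)) :
    ((fun n => √(t n : ℝ)) =o[atTop] (fun n => ⨅ k, Δ n k) →
      SensorFusion.AsympNormal Pr
        (fun n ω => ∑ k, SensorFusion.weight σ k *
          SensorFusion.muHat (Δ n k) (fun i => X k i ω) (t n))
        μ (SensorFusion.fusedSD σ) t) ∧
    (∀ F : Fin K → ℝ → Measure ℝ,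
      (∀ k, SensorFusion.IsMeanFamily (F k)) →
      (∀ k, Measure.map (X k 0) Pr = F k μ) →
      (∀ k, SensorFusion.OvershootConditions (F k) μ) →
      (fun n => (t n : ℝ) ^ (1 / 4 : ℝ)) =o[atTop] (fun n => ⨅ k, Δ n k) →
      SensorFusion.AsympNormal Pr
        (fun n ω => ∑ k, SensorFusion.weight σ k *
          SensorFusion.correct (SensorFusion.rho (F k)) (Δ n k)
            (SensorFusion.muHat (Δ n k) (fun i => X k i ω) (t n)))
        μ (SensorFusion.fusedSD σ) t ∧
      ((fun n => ⨆ k, Δ n k) =o[atTop] (fun n => √(t n : ℝ)) →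
        SensorFusion.AsympNormal Pr
          (fun n ω => ∑ k, SensorFusion.weight σ k *
            SensorFusion.correct (SensorFusion.rho (F k)) (Δ n k)
              (SensorFusion.muCheck (Δ n k) (fun i => X k i ω) (t n)))
          μ (SensorFusion.fusedSD σ) t)) := by
  have hne : Nonempty (Fin K) := ⟨⟨0, hK⟩⟩
  have hp : ∀ k, IsProbabilityMeasure (Pr.map (X k 0)) := fun k =>
    Measure.isProbabilityMeasure_map (hX k 0).aemeasurable
  have hm : ∀ k, ∫ y, y ∂(Pr.map (X k 0)) = μ := fun k => by
    rw [integral_map (hX k 0).aemeasurable (by fun_prop), hmean]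
  have hpos : ∀ k, 0 < ∫ y, y ∂(Pr.map (X k 0)) := fun k => by rw [hm k]; exact hμ
  have h2 : ∀ k, MemLp id 2 (Pr.map (X k 0)) := fun k =>
    (memLp_map_measure_iff (by fun_prop) (hX k 0).aemeasurable).2 (hL2 k)
  have htR : Tendsto (fun n => (t n : ℝ)) atTop atTop := tendsto_natCast_atTop_atTop.comp ht
  refine ⟨fun hΔs => ?_, fun F hF hlaw hover hΔs => ?_⟩
  · have hreg : ∀ k, SensorFusion.Regime t fun n => Δ n k := fun k =>
      SensorFusion.regime_of_isLittleO hΔ ht hΔt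
        (Real.tendsto_sqrt_atTop.comp htR) hΔs k
    refine SensorFusion.asympNormal_of_tendsto hX hindep hident hσ hL2 hmean hvar ht
      (Y := fun k z => SensorFusion.muHat (Δ z.1 k) z.2 (t z.1))
      (fun k n => SensorFusion.aemeasurable_msgCount_lastComm (h2 k) (hpos k) (hΔ n k) (t n)
        fun p => Δ n k * p.1 / p.2) fun k => ?_
    have h1 := SensorFusion.tendsto_div_of_isLittleO_iInf hΔ (fun n => Real.sqrt_nonneg _) hΔs k
    have h3 := SensorFusion.tendsto_muHat_sub (h2 k) (hpos k) (hreg k)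
    exact SensorFusion.tendsto_scaled_estimator (h2 k) (hpos k) (hreg k) h1 h3
  · have hreg : ∀ k, SensorFusion.Regime t fun n => Δ n k := fun k =>
      SensorFusion.regime_of_isLittleO hΔ ht hΔt
        ((tendsto_rpow_atTop (by norm_num)).comp htR) hΔs k
    -- This is the square of `t^{1/4}/Δ → 0`.
    have hsq : ∀ k, Tendsto (fun n => √(t n) / Δ n k / Δ n k) atTop (𝓝 0) := fun k => by
      have h := (SensorFusion.tendsto_div_of_isLittleO_iInf hΔ
        (fun n => by positivity) hΔs k).pow 2
      rw [zero_pow two_ne_zero] at h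
      refine h.congr fun n => ?_
      rw [div_pow, ← Real.rpow_natCast, ← Real.rpow_mul (Nat.cast_nonneg _), Real.sqrt_eq_rpow,
        div_div, ← sq]
      norm_num
    have hcorr : ∀ k {Y : ℕ × (ℕ → ℝ) → ℝ},
        Tendsto (fun z => √(t z.1) * (Y z *
          (1 + SensorFusion.meanOvershoot (Pr.map (X k 0)) (Δ z.1 k) / Δ z.1 k) -
            ∫ y, y ∂(Pr.map (X k 0))) -
          SensorFusion.centeredWalk (Pr.map (X k 0)) z.2 (t z.1) / √(t z.1))
          (SensorFusion.whp (SensorFusion.pathLaw (Pr.map (X k 0)))) (𝓝 0) →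
        Tendsto (fun z => √(t z.1) *
          (SensorFusion.correct (SensorFusion.rho (F k)) (Δ z.1 k) (Y z) -
            ∫ y, y ∂(Pr.map (X k 0))) -
          SensorFusion.centeredWalk (Pr.map (X k 0)) z.2 (t z.1) / √(t z.1))
          (SensorFusion.whp (SensorFusion.pathLaw (Pr.map (X k 0)))) (𝓝 0) := by
      intro k Y hY
      have := (hF k).isProbabilityMeasure μ hμ
      rw [hlaw k] at hY ⊢
      exact SensorFusion.tendsto_scaled_correct_estimator hμ ((hF k).memLp_two μ hμ)
        ((hF k).mean_eq μ hμ) (hover k) (hreg k) (hsq k) hY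
    refine ⟨?_, fun hΔ2 => ?_⟩
    · refine SensorFusion.asympNormal_of_tendsto hX hindep hident hσ hL2 hmean hvar ht
        (Y := fun k z => SensorFusion.correct (SensorFusion.rho (F k)) (Δ z.1 k)
          (SensorFusion.muHat (Δ z.1 k) z.2 (t z.1)))
        (fun k n => SensorFusion.aemeasurable_msgCount_lastComm (h2 k) (hpos k) (hΔ n k) (t n)
          fun p => SensorFusion.correct (SensorFusion.rho (F k)) (Δ n k) (Δ n k * p.1 / p.2))
        fun k => ?_
      have h1 := SensorFusion.tendsto_muHat_sub (h2 k) (hpos k) (hreg k)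
      exact hcorr k (Y := fun z => SensorFusion.muHat (Δ z.1 k) z.2 (t z.1)) h1
    · refine SensorFusion.asympNormal_of_tendsto hX hindep hident hσ hL2 hmean hvar ht
        (Y := fun k z => SensorFusion.correct (SensorFusion.rho (F k)) (Δ z.1 k)
          (SensorFusion.muCheck (Δ z.1 k) z.2 (t z.1)))
        (fun k n => SensorFusion.aemeasurable_msgCount_lastComm (h2 k) (hpos k) (hΔ n k) (t n)
          fun p => SensorFusion.correct (SensorFusion.rho (F k)) (Δ n k) (Δ n k * p.1 / t n))
        fun k => ?_
      have h1 := SensorFusion.tendsto_div_of_iSup_isLittleO hΔ (fun n => Real.sqrt_nonneg _) hΔ2 k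
      have h3 := SensorFusion.tendsto_muCheck_sub (h2 k) (hpos k) (hreg k) h1
      exact hcorr k (Y := fun z => SensorFusion.muCheck (Δ z.1 k) z.2 (t z.1)) h3
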